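/- Let $\Omega\subset\mathbb R^3$ be a bounded domain with boundary of class $C^2$ and outward normal $n$, and let $T>0$, $k>0$. Write $A:B=\sum_{i,j}A_{ij}B_{ij}$, $|A|^2=A:A$, $PA=A-\tfrac13\operatorname{tr}(A)\,\mathrm{Id}$, $\varepsilon(u)=\tfrac12(\nabla u+\nabla^{\top}u)$, and $\mathcal T_K(r)=\min\{K,\max(r,-K)\}$ for $K>0$. Let $\mathcal S$ be the space of symmetric real $3\times3$ matrices and let $\mathbb D:\mathcal S\to\mathcal S$ be a constant linear map, symmetric and positive definite with respect to $A:B$. For $\lambda>0$ let $$Y_\lambda(A)=\frac{(|PA|-k)_+}{2\lambda}\,\frac{PA}{|PA|}\qquad(Y_\lambda(A)=0\text{ if }PA=0).$$ Let $f:\mathbb R\to\mathbb R$ be continuous, and suppose that there are $a,M\ge0$, $\alpha\in(\tfrac12,\tfrac56)$ and $C_0>0$ with $|f(r)|\le a+M|r|^\alpha$ for all $r\in\mathbb R$ and $|f(r)|\le C_0(1+|r|)^{1/2}$ for all $r<0$. Let $F\in L^2(0,T;L^2(\Omega;\mathbb R^3))$, $g_\theta\in H^1(0,T;L^2(\partial\Omega))$,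 $u_0\in H^1(\Omega;\mathbb R^3)$, $\varepsilon^{p,0}\in L^2(\Omega;\mathcal S)$, $\theta_0\in H^1(\Omega)$. Let $\tilde\theta\in H^1(0,T;L^2(\Omega))\cap L^2(0,T;H^1(\Omega))$ be the (weak) solution of $\tilde\theta_t-\Delta\tilde\theta=0$ in $\Omega\times(0,T)$, $\partial\tilde\theta/\partial n=g_\theta$ on $\partial\Omega$, $\tilde\theta(0)=0$. For $\lambda>0$ consider the approximate system in $\Omega\times(0,T)$ $$\begin{aligned} \operatorname{div}\sigma^\lambda&=-F-\operatorname{div}\mathbb D(\varepsilon(u^\lambda_t)),\\ \sigma^\lambda&=T^\lambda-f\big(\mathcal T_{1/\lambda}(\theta^\lambda+\tilde\theta)\big)\mathrm{Id},\qquad T^\lambda=\mathbb D(\varepsilon(u^\lambda)-\varepsilon^{p,\lambda}),\\ \varepsilon^{p,\lambda}_t&=Y_\lambda(T^\lambda),\\ \theta^\lambda_t-\Delta\theta^\lambda&=-f\big(\mathcal T_{1/\lambda}(\theta^\lambda+\tilde\theta)\big)\operatorname{div}u^\lambda_t+\mathcal T_{1/\lambda}\big(\varepsilon^{p,\lambda}_t:T^\lambda\big),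 \end{aligned}$$ with $u^\lambda=0$ and $\partial\theta^\lambda/\partial n=0$ on $\partial\Omega$, and $u^\lambda(0)=u_0$, $\varepsilon^{p,\lambda}(0)=\varepsilon^{p,0}$, $\theta^\lambda(0)=\theta_0$. A solution is a triple $u^\lambda\in H^1(0,T;H^1_0(\Omega;\mathbb R^3))$, $\varepsilon^{p,\lambda}\in H^1(0,T;L^2(\Omega;\mathcal S))$, $\theta^\lambda\in H^1(0,T;L^2(\Omega))\cap L^2(0,T;H^1(\Omega))$ that satisfies the first equation in the sense of distributions in $\Omega$ for a.e. $t$, the flow rule a.e. in $\Omega\times(0,T)$, and the heat equation with its Neumann condition in the weak form (tested with all $v\in H^1(\Omega)$, for a.e. $t$); functions in $H^1(0,T;X)$ are identified with their continuous representatives. **Theorem.** For every $K>0$ there is a constant $C(T)>0$, not depending on $\lambda$, such that for every $\lambda>0$, every solution $(u^\lambda,\varepsilon^{p,\lambda},\theta^\lambda)$ of the approximate system and every $t\in[0,T]$ $$\int_\Omega|T^\lambda(t)|^2\,dx+\int_0^t\!\!\int_\Omega|\varepsilon(u^\lambda_t(\tau))|^2\,dx\,d\tau+\int_\Omega|\theta^\lambda(t)|\,dx+\int_0^t\!\!\int_\Omega|\nabla\mathcal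 T_K(\theta^\lambda(\tau))|^2\,dx\,d\tau\le C(T).$$ In particular $\mathcal T_K(\theta^\lambda(\tau))\in H^1(\Omega)$ for a.e. $\tau$, and all these integrals are finite. -/

import Mathlib

open MeasureTheory Set

noncomputable section

namespace ThermoPlasticity

/-- The physical space `ℝ³` with its Euclidean norm. -/
abbrev E3 : Type := EuclideanSpace ℝ (Fin 3)

/-- Real `3 × 3` matrices. -/
abbrev Mat3 : Type := Matrix (Fin 3) (Fin 3) ℝ

/-! ### Algebra of matrices -/

/-- The double contraction `A : B = ∑ A_ij B_ij`. -/
def ddot (A B : Mat3) : ℝ := ∑ i, ∑ j, A i j * B i j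

/-- The norm `|A| = (A : A)^(1/2)`. -/
def frob (A : Mat3) : ℝ := Real.sqrt (ddot A A)

/-- The deviatoric part `P A = A - (1/3) tr(A) Id`. -/
def dev (A : Mat3) : Mat3 := A - (Matrix.trace A / 3) • (1 : Mat3)

/-- The symmetric part of a matrix (applied to `∇u`, it is the linearised strain). -/
def symPart (G : Mat3) : Mat3 := (1 / 2 : ℝ) • (G + G.transpose)

/-- A constant elasticity tensor: it acts on the symmetric matrices, where it is symmetric and
positive definite. (Its values at other matrices are never used.) -/
structure IsElasticityTensor (D : Mat3 →ₗ[ℝ] Mat3) : Prop where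
  map_symm : ∀ A : Mat3, A.IsSymm → (D A).IsSymm
  symmetric : ∀ A B : Mat3, A.IsSymm → B.IsSymm → ddot (D A) B = ddot A (D B)
  pos_def : ∀ A : Mat3, A.IsSymm → A ≠ 0 → 0 < ddot (D A) A

/-- The truncation at height `K`. -/
def trunc (K r : ℝ) : ℝ := min K (max r (-K))

/-- The Yosida approximation `Y_lam` of the subdifferential of the indicator function of the
von Mises set `{A symmetric : |P A| ≤ k}`:
`Y_lam(A) = (|P A| - k)₊ / (2 lam) * P A / |P A|`, with value `0` where `P A = 0`. -/
def yosida (k lam : ℝ) (A : Mat3) : Mat3 :=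
  (max 0 (frob (dev A) - k) / (2 * lam)) • ((frob (dev A))⁻¹ • dev A)

/-! ### The domain -/

/-- The boundary of `Ω` is of class `C²`: near each boundary point, after a rigid change of the
coordinate axes, `Ω` is the part above the graph of a `C²` function. -/
def HasC2Boundary (Ω : Set E3) : Prop :=
  ∀ p ∈ frontier Ω, ∃ r : ℝ, 0 < r ∧ ∃ R : E3 ≃ₗᵢ[ℝ] E3, ∃ γ : ℝ × ℝ → ℝ, ContDiff ℝ 2 γ ∧
    Ω ∩ Metric.ball p r = {x ∈ Metric.ball p r | γ ((R x) 0, (R x) 1) < (R x) 2}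

/-- A bounded domain (nonempty connected open set) with boundary of class `C²`. -/
structure IsBoundedC2Domain (Ω : Set E3) : Prop where
  isOpen : IsOpen Ω
  isConnected : IsConnected Ω
  isBounded : Bornology.IsBounded Ω
  boundary : HasC2Boundary Ω

/-- Lebesgue measure on `Ω`. -/
abbrev bulk (Ω : Set E3) : Measure E3 := volume.restrict Ω

/-- Surface measure on `∂Ω`: the two-dimensional Hausdorff measure, normalised so that it is
Lebesgue measure on planes. -/
abbrev surf (Ω : Set E3) : Measure E3 := (μHE[2] : Measure E3).restrict (frontier Ω)

/-- Product of Lebesgue measure on the time interval `(0, T)` and of `μ`. -/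
abbrev timeProd (T : ℝ) (μ : Measure E3) : Measure (ℝ × E3) :=
  (volume.restrict (Ioo (0 : ℝ) T)).prod μ

/-! ### Sobolev spaces -/

/-- The classical partial derivative in the direction of the `i`-th coordinate. -/
def pderiv (i : Fin 3) (φ : E3 → ℝ) (x : E3) : ℝ :=
  fderiv ℝ φ x (EuclideanSpace.single i (1 : ℝ))

/-- `φ ∈ C_c^∞(Ω)`. -/
structure IsTest (Ω : Set E3) (φ : E3 → ℝ) : Prop where
  smooth : ContDiff ℝ ((⊤ : ℕ∞) : WithTop ℕ∞) φ
  compact : HasCompactSupport φ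
  subset : tsupport φ ⊆ Ω

/-- `g` is the weak gradient of `w` in `Ω` (used for locally integrable `w`, `g` only). -/
def IsWeakGrad (Ω : Set E3) (w : E3 → ℝ) (g : E3 → Fin 3 → ℝ) : Prop :=
  ∀ φ : E3 → ℝ, IsTest Ω φ → ∀ i : Fin 3,
    ∫ x in Ω, w x * pderiv i φ x = - ∫ x in Ω, g x i * φ x

/-- `w ∈ H¹(Ω)` with weak gradient `g ∈ L²(Ω; ℝ³)`. -/
structure MemH1 (Ω : Set E3) (w : E3 → ℝ) (g : E3 → Fin 3 → ℝ) : Prop where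
  memLp : MemLp w 2 (bulk Ω)
  grad_memLp : ∀ i, MemLp (fun x => g x i) 2 (bulk Ω)
  weakGrad : IsWeakGrad Ω w g

/-- `w ∈ H¹₀(Ω)` with weak gradient `g`: `(w, g)` is the limit in `L²` of pairs `(φ, ∇φ)` with
`φ ∈ C_c^∞(Ω)`. -/
structure MemH10 (Ω : Set E3) (w : E3 → ℝ) (g : E3 → Fin 3 → ℝ) : Prop where
  memH1 : MemH1 Ω w g
  approx : ∀ δ : ENNReal, 0 < δ → ∃ φ : E3 → ℝ, IsTest Ω φ ∧
    eLpNorm (fun x => w x - φ x) 2 (bulk Ω) ≤ δ ∧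
    ∀ i, eLpNorm (fun x => g x i - pderiv i φ x) 2 (bulk Ω) ≤ δ

/-- `w ∈ H¹(0, T; L²(μ))` with time derivative `w'`, the function `t ↦ w t` being the continuous
representative: `w, w' ∈ L²((0,T) × μ)` and `w t = w 0 + ∫₀ᵗ w'` in `L²(μ)` for all
`t ∈ [0, T]`. -/
structure IsTimeH1 (T : ℝ) (μ : Measure E3) (w w' : ℝ → E3 → ℝ) : Prop where
  memLp : MemLp (Function.uncurry w) 2 (timeProd T μ)
  deriv_memLp : MemLp (Function.uncurry w') 2 (timeProd T μ)
  init_memLp : MemLp (w 0) 2 μ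
  eq_integral : ∀ t ∈ Icc (0 : ℝ) T, ∀ᵐ x ∂μ, w t x = w 0 x + ∫ s in (0 : ℝ)..t, w' s x

/-! ### The linear heat problem that lifts the Neumann datum -/

/-- `th ∈ H¹(0, T; L²(Ω)) ∩ L²(0, T; H¹(Ω))`, with time derivative `tht` and spatial gradient
`Gth`. -/
structure IsHeatRegular (Ω : Set E3) (T : ℝ) (th tht : ℝ → E3 → ℝ)
    (Gth : ℝ → E3 → Fin 3 → ℝ) : Prop where
  time : IsTimeH1 T (bulk Ω) th tht
  grad_memLp : ∀ i, MemLp (fun p : ℝ × E3 => Gth p.1 p.2 i) 2 (timeProd T (bulk Ω))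
  grad : ∀ᵐ t ∂(volume.restrict (Ioo (0 : ℝ) T)), MemH1 Ω (th t) (Gth t)

/-- `th` is the solution of the heat equation `th_t - Δ th = 0` in `Ω × (0, T)`, with
`∂th/∂n = g` on `∂Ω` and `th = 0` at time `0`. The boundary condition is contained in the weak
form; the test functions are the restrictions to `Ω` of smooth functions on `ℝ³`. -/
def IsNeumannLift (Ω : Set E3) (T : ℝ) (g th : ℝ → E3 → ℝ) : Prop :=
  ∃ (tht : ℝ → E3 → ℝ) (Gth : ℝ → E3 → Fin 3 → ℝ),
    IsHeatRegular Ω T th tht Gth ∧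
    (∀ᵐ x ∂(bulk Ω), th 0 x = 0) ∧
    ∀ᵐ t ∂(volume.restrict (Ioo (0 : ℝ) T)),
      ∀ v : E3 → ℝ, ContDiff ℝ ((⊤ : ℕ∞) : WithTop ℕ∞) v →
        (∫ x in Ω, tht t x * v x) + ∫ x in Ω, ∑ i, Gth t x i * pderiv i v x
          = ∫ x, g t x * v x ∂(surf Ω)

/-! ### The approximate system -/

/-- The unknowns of the approximate system and their derivatives:
displacement `u`, its time derivative `ut`, the spatial gradients `Gu`, `Gut` of these
(`(Gu t x) i j = ∂_j u_i`), plastic strain `ep` and its time derivative `ept`,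
temperature `th`, its time derivative `tht` and its spatial gradient `Gth`. -/
structure Fields where
  u : ℝ → E3 → Fin 3 → ℝ
  ut : ℝ → E3 → Fin 3 → ℝ
  Gu : ℝ → E3 → Mat3
  Gut : ℝ → E3 → Mat3
  ep : ℝ → E3 → Mat3
  ept : ℝ → E3 → Mat3
  th : ℝ → E3 → ℝ
  tht : ℝ → E3 → ℝ
  Gth : ℝ → E3 → Fin 3 → ℝ

namespace Fields

/-- `ε(u)`. -/
def strain (s : Fields) (t : ℝ) (x : E3) : Mat3 := symPart (s.Gu t x)

/-- `ε(u_t)`. -/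
def strainRate (s : Fields) (t : ℝ) (x : E3) : Mat3 := symPart (s.Gut t x)

/-- `div u_t`. -/
def divRate (s : Fields) (t : ℝ) (x : E3) : ℝ := Matrix.trace (s.Gut t x)

/-- The elastic stress `D(ε(u) - ε^p)` (denoted by `T^lam` in the literature). -/
def stress (s : Fields) (D : Mat3 →ₗ[ℝ] Mat3) (t : ℝ) (x : E3) : Mat3 :=
  D (s.strain t x - s.ep t x)

/-- The truncated thermal stress coefficient `f(T_{1/lam}(th + thl))`, where `thl` is the lift of
the Neumann datum. -/
def thermal (s : Fields) (f : ℝ → ℝ) (lam : ℝ) (thl : ℝ → E3 → ℝ) (t : ℝ) (x : E3) : ℝ :=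
  f (trunc (1 / lam) (s.th t x + thl t x))

/-- The total stress `σ = D(ε(u) - ε^p) - f(T_{1/lam}(th + thl)) Id`. -/
def totalStress (s : Fields) (D : Mat3 →ₗ[ℝ] Mat3) (f : ℝ → ℝ) (lam : ℝ)
    (thl : ℝ → E3 → ℝ) (t : ℝ) (x : E3) : Mat3 :=
  s.stress D t x - s.thermal f lam thl t x • (1 : Mat3)

end Fields

/-- `s` is an `L²`-solution on `(0, T)` of the approximate system (Yosida approximation of the
flow rule and truncation of the temperature and of the dissipation, both with parameter `lam`),
with `u = 0` and `∂th/∂n = 0` on `∂Ω` and the initial data `u0`, `ep0`, `th0`. -/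
structure IsApproxSolution (Ω : Set E3) (T : ℝ) (D : Mat3 →ₗ[ℝ] Mat3) (k : ℝ) (f : ℝ → ℝ)
    (F : ℝ → E3 → Fin 3 → ℝ) (u0 : E3 → Fin 3 → ℝ) (ep0 : E3 → Mat3) (th0 : E3 → ℝ)
    (thl : ℝ → E3 → ℝ) (lam : ℝ) (s : Fields) : Prop where
  -- `u ∈ H¹(0, T; H¹₀(Ω; ℝ³))`
  u_time : ∀ i, IsTimeH1 T (bulk Ω) (fun t x => s.u t x i) (fun t x => s.ut t x i)
  Gu_time : ∀ i j, IsTimeH1 T (bulk Ω) (fun t x => s.Gu t x i j) (fun t x => s.Gut t x i j)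
  u_memH10 : ∀ t ∈ Icc (0 : ℝ) T, ∀ i,
    MemH10 Ω (fun x => s.u t x i) (fun x j => s.Gu t x i j)
  ut_memH10 : ∀ᵐ t ∂(volume.restrict (Ioo (0 : ℝ) T)), ∀ i,
    MemH10 Ω (fun x => s.ut t x i) (fun x j => s.Gut t x i j)
  -- `ε^p ∈ H¹(0, T; L²(Ω))` with values in the symmetric matrices
  ep_time : ∀ i j, IsTimeH1 T (bulk Ω) (fun t x => s.ep t x i j) (fun t x => s.ept t x i j)
  ep_symm : ∀ t ∈ Icc (0 : ℝ) T, ∀ᵐ x ∂(bulk Ω), (s.ep t x).IsSymm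
  -- `th ∈ H¹(0, T; L²(Ω)) ∩ L²(0, T; H¹(Ω))`
  th_regular : IsHeatRegular Ω T s.th s.tht s.Gth
  -- initial conditions
  u_init : ∀ᵐ x ∂(bulk Ω), s.u 0 x = u0 x
  ep_init : ∀ᵐ x ∂(bulk Ω), s.ep 0 x = ep0 x
  th_init : ∀ᵐ x ∂(bulk Ω), s.th 0 x = th0 x
  -- `div σ = - F - div D(ε(u_t))` in the sense of distributions in `Ω`, for a.e. time
  momentum : ∀ᵐ t ∂(volume.restrict (Ioo (0 : ℝ) T)),
    ∀ φ : Fin 3 → E3 → ℝ, (∀ i, IsTest Ω (φ i)) →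
      ∫ x in Ω, ddot (s.totalStress D f lam thl t x + D (s.strainRate t x))
          (Matrix.of fun i j => pderiv j (φ i) x)
        = ∫ x in Ω, ∑ i, F t x i * φ i x
  -- `ε^p_t = Y_lam(D(ε(u) - ε^p))`
  flow : ∀ᵐ p ∂(timeProd T (bulk Ω)), s.ept p.1 p.2 = yosida k lam (s.stress D p.1 p.2)
  -- `th_t - Δ th = - f(T_{1/lam}(th + thl)) div u_t + T_{1/lam}(ε^p_t : D(ε(u) - ε^p))` with
  -- the homogeneous Neumann condition, in weak form
  heat : ∀ᵐ t ∂(volume.restrict (Ioo (0 : ℝ) T)),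
    ∀ (v : E3 → ℝ) (Gv : E3 → Fin 3 → ℝ), MemH1 Ω v Gv →
      (∫ x in Ω, s.tht t x * v x) + ∫ x in Ω, ∑ i, s.Gth t x i * Gv x i
        = ∫ x in Ω, (- s.thermal f lam thl t x * s.divRate t x
            + trunc (1 / lam) (ddot (s.ept t x) (s.stress D t x))) * v x

end ThermoPlasticity

end

/-! The estimate is an energy balance in which the thermal coupling cancels exactly where the
temperature is large. Test the momentum equation with $u_t$ and add $1/K$ times the heat equation
tested with $\mathcal T_K(\theta)$. The two coupling terms combine to $\int f(\mathcal
T_{1/\lambda}(\theta+\tilde\theta))\,(1-\mathcal T_K(\theta)/K)\,\operatorname{div}u_t$, and the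
weight vanishes on $\{\theta\ge K\}$.

On $\{\theta<K\}$ two cases remain. If the argument of $f$ is negative, the square root growth gives
$f^2\le C(1+|\theta|+|\tilde\theta|)$. If it is nonnegative, it is at most $K+|\tilde\theta|$, and
at most linear growth of $f$ suffices. In both cases the squared coefficient of
$\operatorname{div}u_t$ is at most $C(1+|\theta|+\tilde\theta^2)$, with $C$ independent of the
truncation level (`exists_growth_bound`). Young's inequality then absorbs $\operatorname{div}u_t$
into the viscous dissipation (`mul_trace_le`). The plastic dissipation is nonnegative, and the
momentum equation supplies at least as much of it as the tested heat source consumes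
(`trunc_mul_le`). The force term needs only a Poincaré inequality for $u_i$ in the direction $x_i$,
because $\partial_iu_i$ is a diagonal entry of the strain; Korn's inequality is not needed. This
gives `energy_inequality_slice`.

Integration in time turns the elastic power into an increment of $\frac12\int\mathbb D E:E$, where
$E=\varepsilon(u)-\varepsilon^p$, and $\int\mathcal T_K(\theta)\theta_t$ into an increment of
$\int\Phi_K(\theta)$ with $\Phi_K'=\mathcal T_K$ (`truncPrim`). Since $\Phi_K(r)/K\ge|r|-K/2$, the
left side controls $\|\theta(t)\|_{L^1}$, while the right side contains only
$\int_0^t\|\theta\|_{L^1}$. Gronwall's inequality concludes.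

The remaining work justifies the test functions and the time derivatives: truncation in $H^1$
(`MemH1.trunc`, by mollification), density of test functions in $H^1_0$, and absolute continuity of
almost every path $t\mapsto w(t,x)$ (`IsTimeH1.ae_path`). -/

open MeasureTheory Set

noncomputable section
namespace ThermoPlasticity

/-! ### Algebra of matrices -/

lemma ddot_add_left (A B C : Mat3) : ddot (A + B) C = ddot A C + ddot B C := by
  simp only [ddot, Matrix.add_apply, add_mul, Finset.sum_add_distrib]

lemma ddot_sub_left (A B C : Mat3) : ddot (A - B) C = ddot A C - ddot B C := by
  simp only [ddot, Matrix.sub_apply, sub_mul, Finset.sum_sub_distrib]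

lemma ddot_sub_right (A B C : Mat3) : ddot A (B - C) = ddot A B - ddot A C := by
  simp only [ddot, Matrix.sub_apply, mul_sub, Finset.sum_sub_distrib]

lemma ddot_smul_left (a : ℝ) (A B : Mat3) : ddot (a • A) B = a * ddot A B := by
  simp only [ddot, Matrix.smul_apply, smul_eq_mul, Finset.mul_sum, mul_assoc]

lemma ddot_smul_right (a : ℝ) (A B : Mat3) : ddot A (a • B) = a * ddot A B := by
  simp only [ddot, Matrix.smul_apply, smul_eq_mul, Finset.mul_sum, mul_left_comm]

lemma ddot_comm (A B : Mat3) : ddot A B = ddot B A := by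
  simp only [ddot, mul_comm]

lemma ddot_one_left (A : Mat3) : ddot 1 A = A.trace := by
  simp [ddot, Matrix.trace, Matrix.one_apply]

lemma ddot_self_nonneg (A : Mat3) : 0 ≤ ddot A A :=
  Finset.sum_nonneg fun _ _ => Finset.sum_nonneg fun _ _ => mul_self_nonneg _

lemma sq_entry_le_ddot (A : Mat3) (i j : Fin 3) : A i j ^ 2 ≤ ddot A A := by
  have h1 : A i j * A i j ≤ ∑ j, A i j * A i j :=
    Finset.single_le_sum (f := fun j => A i j * A i j) (fun _ _ => mul_self_nonneg _)
      (Finset.mem_univ j)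
  have h2 : ∑ j, A i j * A i j ≤ ddot A A :=
    Finset.single_le_sum (f := fun i => ∑ j, A i j * A i j)
      (fun _ _ => Finset.sum_nonneg fun _ _ => mul_self_nonneg _) (Finset.mem_univ i)
  nlinarith

lemma ddot_self_eq_zero {A : Mat3} (h : ddot A A = 0) : A = 0 := by
  ext i j
  have := sq_entry_le_ddot A i j
  have h0 : A i j ^ 2 = 0 := le_antisymm (by linarith) (sq_nonneg _)
  simpa using h0

lemma frob_sq (A : Mat3) : frob A ^ 2 = ddot A A := Real.sq_sqrt (ddot_self_nonneg A)

lemma frob_nonneg (A : Mat3) : 0 ≤ frob A := Real.sqrt_nonneg _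

lemma continuous_ddot_self : Continuous fun A : Mat3 => ddot A A := by
  unfold ddot
  fun_prop

lemma isSymm_symPart (G : Mat3) : (symPart G).IsSymm := by
  ext i j
  simp only [symPart, Matrix.transpose_apply, Matrix.smul_apply, Matrix.add_apply, add_comm]

lemma trace_symPart (G : Mat3) : (symPart G).trace = G.trace := by
  simp [symPart, Matrix.trace_smul, Matrix.trace_add]
  ring

lemma symPart_diag (G : Mat3) (i : Fin 3) : symPart G i i = G i i := by
  simp [symPart]
  ring

/-- A symmetric matrix is orthogonal to antisymmetric ones. Thus the full gradient in the tested
momentum equation may be replaced by the strain. -/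
lemma ddot_symPart {S : Mat3} (hS : S.IsSymm) (G : Mat3) : ddot S (symPart G) = ddot S G := by
  have h : ∀ i j, S j i = S i j := fun i j => hS.apply i j
  simp only [ddot, symPart, Matrix.smul_apply, Matrix.add_apply, Matrix.transpose_apply,
    smul_eq_mul, Fin.sum_univ_three]
  rw [h 0 1, h 0 2, h 1 2]
  ring

lemma trace_sq_le (A : Mat3) : A.trace ^ 2 ≤ 3 * ddot A A := by
  simp only [ddot, Matrix.trace, Matrix.diag_apply, Fin.sum_univ_three]
  nlinarith [sq_nonneg (A 0 0 - A 1 1), sq_nonneg (A 0 0 - A 2 2), sq_nonneg (A 1 1 - A 2 2),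
    sq_nonneg (A 0 1), sq_nonneg (A 0 2), sq_nonneg (A 1 0), sq_nonneg (A 1 2),
    sq_nonneg (A 2 0), sq_nonneg (A 2 1)]

lemma sum_diag_sq_le (A : Mat3) : ∑ i, A i i ^ 2 ≤ ddot A A := by
  unfold ddot
  refine Finset.sum_le_sum fun i _ => ?_
  rw [sq]
  exact Finset.single_le_sum (f := fun j => A i j * A i j) (fun _ _ => mul_self_nonneg _)
    (Finset.mem_univ i)

/-- Any two quadratic forms on symmetric matrices of which the second is positive definite are
comparable. -/
lemma exists_quadratic_le {p q : Mat3 → ℝ} (hp : Continuous p) (hq : Continuous q)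
    (hp2 : ∀ (a : ℝ) A, p (a • A) = a ^ 2 * p A) (hq2 : ∀ (a : ℝ) A, q (a • A) = a ^ 2 * q A)
    (hpos : ∀ A : Mat3, A.IsSymm → A ≠ 0 → 0 < q A) :
    ∃ C : ℝ, 0 < C ∧ ∀ A : Mat3, A.IsSymm → p A ≤ C * q A := by
  -- Both forms are homogeneous of degree two, so it suffices to bound `p / q` on the compact unit
  -- sphere of symmetric matrices.
  let S : Set Mat3 := {A | A.IsSymm ∧ ddot A A = 1}
  have hcl : IsClosed S := by
    refine IsClosed.inter ?_ (isClosed_eq continuous_ddot_self continuous_const)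
    exact isClosed_eq (continuous_id.matrix_transpose) continuous_id
  have hsub : S ⊆ Set.pi univ fun _ => Set.pi univ fun _ => Icc (-1 : ℝ) 1 := by
    rintro A ⟨-, h⟩ i - j -
    have := sq_entry_le_ddot A i j
    rw [h] at this
    exact abs_le.mp ((sq_le_one_iff_abs_le_one _).mp this)
  have hcomp : IsCompact S :=
    (isCompact_univ_pi fun _ => isCompact_univ_pi fun _ => isCompact_Icc).of_isClosed_subset
      hcl hsub
  have hne : ∀ A ∈ S, q A ≠ 0 := by
    rintro A ⟨hA, h⟩
    refine (hpos A hA ?_).ne'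
    rintro rfl
    simp [ddot] at h
  obtain ⟨C, hC⟩ := (hcomp.image_of_continuousOn
    (f := fun A => p A / q A) (hp.continuousOn.div hq.continuousOn hne)).bddAbove
  have hq0 : q 0 = 0 := by simpa using hq2 0 0
  have hp0 : p 0 = 0 := by simpa using hp2 0 0
  refine ⟨max C 1, by positivity, fun A hA => ?_⟩
  by_cases h0 : A = 0
  · simp [h0, hq0, hp0]
  have hd : 0 < ddot A A :=
    lt_of_le_of_ne (ddot_self_nonneg A) fun h => h0 (ddot_self_eq_zero h.symm)
  have hf : 0 < frob A := Real.sqrt_pos.mpr hd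
  have hmem : (frob A)⁻¹ • A ∈ S := by
    refine ⟨hA.smul _, ?_⟩
    rw [ddot_smul_left, ddot_smul_right, ← frob_sq]
    field_simp
  have h := hC ⟨_, hmem, rfl⟩
  simp only [hp2, hq2] at h
  rw [mul_div_mul_left _ _ (by positivity)] at h
  have hqA := hpos A hA h0
  rw [div_le_iff₀ hqA] at h
  exact h.trans (mul_le_mul_of_nonneg_right (le_max_left _ _) hqA.le)

lemma continuous_linearMap (D : Mat3 →ₗ[ℝ] Mat3) : Continuous D :=
  LinearMap.continuous_of_finiteDimensional D

/-! ### Bounds for the elasticity tensor -/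

namespace IsElasticityTensor

variable {D : Mat3 →ₗ[ℝ] Mat3}

lemma exists_coercive (hD : IsElasticityTensor D) :
    ∃ c : ℝ, 0 < c ∧ ∀ A : Mat3, A.IsSymm → c * ddot A A ≤ ddot (D A) A := by
  have hDc := continuous_linearMap D
  obtain ⟨C, hC, h⟩ := exists_quadratic_le (p := fun A => ddot A A) (q := fun A => ddot (D A) A)
    continuous_ddot_self (by unfold ddot; fun_prop)
    (fun a A => by rw [ddot_smul_left, ddot_smul_right]; ring)
    (fun a A => by rw [map_smul, ddot_smul_left, ddot_smul_right]; ring) hD.pos_def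
  refine ⟨C⁻¹, by positivity, fun A hA => ?_⟩
  rw [inv_mul_le_iff₀ hC]
  exact h A hA

/-- Converts control of the stored energy into control of the stress. -/
lemma exists_ddot_apply_le (hD : IsElasticityTensor D) :
    ∃ C : ℝ, 0 < C ∧ ∀ A : Mat3, A.IsSymm → ddot (D A) (D A) ≤ C * ddot (D A) A := by
  have hDc := continuous_linearMap D
  exact exists_quadratic_le (p := fun A => ddot (D A) (D A)) (q := fun A => ddot (D A) A)
    (by unfold ddot; fun_prop) (by unfold ddot; fun_prop)
    (fun a A => by rw [map_smul, ddot_smul_left, ddot_smul_right]; ring)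
    (fun a A => by rw [map_smul, ddot_smul_left, ddot_smul_right]; ring) hD.pos_def

end IsElasticityTensor

/-- Entries of `D A` are fixed linear combinations of entries of `A`, so square integrability and
time regularity pass from `A` to `D A`. -/
lemma linearMap_apply_entry (D : Mat3 →ₗ[ℝ] Mat3) (A : Mat3) (i j : Fin 3) :
    D A i j = ∑ k, ∑ l, D (Matrix.single k l 1) i j * A k l := by
  conv_lhs => rw [Matrix.matrix_eq_sum_single A]
  simp only [map_sum, Matrix.sum_apply]
  refine Finset.sum_congr rfl fun k _ => Finset.sum_congr rfl fun l _ => ?_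
  rw [show Matrix.single k l (A k l) = A k l • Matrix.single k l (1 : ℝ) by simp, map_smul,
    Matrix.smul_apply, smul_eq_mul, mul_comm]

lemma isSymm_dev {A : Mat3} (hA : A.IsSymm) : (dev A).IsSymm :=
  hA.sub (Matrix.isSymm_one.smul _)

lemma ddot_dev_self (A : Mat3) : ddot (dev A) A = ddot (dev A) (dev A) := by
  simp only [ddot, dev, Matrix.trace, Matrix.diag_apply, Fin.sum_univ_three, Matrix.sub_apply,
    Matrix.smul_apply, Matrix.one_apply, smul_eq_mul]
  simp
  ring

lemma isSymm_yosida {k lam : ℝ} {A : Mat3} (hA : A.IsSymm) : (yosida k lam A).IsSymm :=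
  ((isSymm_dev hA).smul _).smul _

/-- `yosida` is a nonnegative multiple of `dev A`, and `dev A` is trace free, hence orthogonal to `A
- dev A`. -/
lemma ddot_yosida_nonneg {k lam : ℝ} (hlam : 0 < lam) (A : Mat3) :
    0 ≤ ddot (yosida k lam A) A := by
  rw [yosida, ddot_smul_left, ddot_smul_left, ddot_dev_self]
  have := ddot_self_nonneg (dev A)
  have := frob_nonneg (dev A)
  have : 0 ≤ max 0 (frob (dev A) - k) := le_max_left _ _
  positivity

/-! ### The truncation -/

/-- Replacing $|x|$ here by $\sqrt{x^2+d^2}$ yields the smooth approximation `smoothTrunc`. -/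
lemma trunc_eq_abs {K : ℝ} (hK : 0 ≤ K) (r : ℝ) : trunc K r = (|r + K| - |r - K|) / 2 := by
  unfold trunc
  rcases le_total r (-K) with h | h
  · rw [max_eq_right h, min_eq_right (by linarith), abs_of_nonpos (by linarith),
      abs_of_nonpos (by linarith)]
    ring
  · rw [max_eq_left h]
    rcases le_total K r with h' | h'
    · rw [min_eq_left h', abs_of_nonneg (by linarith), abs_of_nonneg (by linarith)]
      ring
    · rw [min_eq_right h', abs_of_nonneg (by linarith), abs_of_nonpos (by linarith)]
      ring

lemma continuous_trunc (K : ℝ) : Continuous (trunc K) := by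
  unfold trunc
  fun_prop

lemma abs_trunc_le {K : ℝ} (hK : 0 ≤ K) (r : ℝ) : |trunc K r| ≤ K := by
  unfold trunc
  rw [abs_le]
  constructor
  · exact le_min (by linarith) (le_max_right _ _)
  · exact min_le_left _ _

lemma trunc_of_ge {K r : ℝ} (h : K ≤ r) : trunc K r = K := by
  unfold trunc
  exact min_eq_left (h.trans (le_max_left _ _))

lemma trunc_cases {K : ℝ} (hK : 0 ≤ K) (r : ℝ) :
    (r ≤ -K ∧ trunc K r = -K) ∨ (-K ≤ r ∧ r ≤ K ∧ trunc K r = r) ∨ (K ≤ r ∧ trunc K r = K) := by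
  unfold trunc
  rcases le_total r (-K) with h | h
  · left; exact ⟨h, by rw [max_eq_right h, min_eq_right (by linarith)]⟩
  · right
    rw [max_eq_left h]
    rcases le_total K r with h' | h'
    · right; exact ⟨h', min_eq_left h'⟩
    · left; exact ⟨h, h', min_eq_right h'⟩

lemma trunc_nonneg {K r : ℝ} (hK : 0 ≤ K) (hr : 0 ≤ r) : 0 ≤ trunc K r :=
  le_min hK (hr.trans (le_max_left _ _))

lemma trunc_le_self {K r : ℝ} (hK : 0 ≤ K) (hr : 0 ≤ r) : trunc K r ≤ r :=
  (min_le_right _ _).trans (max_le le_rfl (by linarith))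

/-- With `z` the plastic dissipation, the heat source tested with $\mathcal T_K(\theta)/K\le1$ never
exceeds the dissipation available in the momentum balance. -/
lemma trunc_mul_le {K L z r : ℝ} (hK : 0 < K) (hL : 0 ≤ L) (hz : 0 ≤ z) :
    trunc L z * (trunc K r / K) ≤ z := by
  have h1 : trunc K r / K ≤ 1 := by
    rw [div_le_one hK]
    exact (le_abs_self _).trans (abs_trunc_le hK.le r)
  have h2 := trunc_nonneg hL hz
  have h3 := trunc_le_self hL hz
  nlinarith

/-- The primitive `∫₀ʳ trunc K` of the truncation. -/
def truncPrim (K r : ℝ) : ℝ := r * trunc K r - trunc K r ^ 2 / 2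

/-- A first-order expansion with quadratic remainder, valid because `trunc K` is 1-Lipschitz. It
gives the derivative of `truncPrim K` everywhere, without separate treatment of the kinks. -/
lemma abs_truncPrim_sub_le {K : ℝ} (hK : 0 ≤ K) (a b : ℝ) :
    |truncPrim K b - truncPrim K a - (b - a) * trunc K a| ≤ (b - a) ^ 2 := by
  unfold truncPrim
  rcases trunc_cases hK a with ⟨h1, h2⟩ | ⟨h1, h1', h2⟩ | ⟨h1, h2⟩ <;>
  rcases trunc_cases hK b with ⟨h3, h4⟩ | ⟨h3, h3', h4⟩ | ⟨h3, h4⟩ <;>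
  rw [h2, h4, abs_le] <;> constructor <;> nlinarith

lemma hasDerivAt_truncPrim {K : ℝ} (hK : 0 ≤ K) (a : ℝ) :
    HasDerivAt (truncPrim K) (trunc K a) a := by
  rw [hasDerivAt_iff_isLittleO]
  refine Asymptotics.IsBigO.trans_isLittleO (g := fun b => (b - a) ^ 2) ?_ ?_
  · refine Asymptotics.IsBigO.of_bound 1 (Filter.Eventually.of_forall fun b => ?_)
    rw [Real.norm_eq_abs, Real.norm_eq_abs, abs_of_nonneg (sq_nonneg (b - a)), one_mul,
      smul_eq_mul]
    exact abs_truncPrim_sub_le hK a b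
  · have h := (Asymptotics.isLittleO_pow_sub_sub a one_lt_two).norm_left
    exact (h.congr_left fun b => by simp)

lemma truncPrim_le {K : ℝ} (hK : 0 ≤ K) (r : ℝ) : truncPrim K r ≤ K * |r| := by
  unfold truncPrim
  rcases trunc_cases hK r with ⟨h1, h2⟩ | ⟨h1, h1', h2⟩ | ⟨h1, h2⟩ <;> rw [h2] <;>
  rcases abs_cases r with ⟨h, _⟩ | ⟨h, _⟩ <;> rw [h] <;> nlinarith

/-- This linear lower bound is what lets the energy control the $L^1$ norm of the temperature. -/
lemma le_truncPrim {K : ℝ} (hK : 0 ≤ K) (r : ℝ) : K * |r| - K ^ 2 / 2 ≤ truncPrim K r := by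
  unfold truncPrim
  rcases trunc_cases hK r with ⟨h1, h2⟩ | ⟨h1, h1', h2⟩ | ⟨h1, h2⟩ <;> rw [h2] <;>
  rcases abs_cases r with ⟨h, _⟩ | ⟨h, _⟩ <;> rw [h] <;>
  nlinarith [sq_nonneg (r - K), sq_nonneg (r + K)]

lemma truncPrim_nonneg {K : ℝ} (hK : 0 ≤ K) (r : ℝ) : 0 ≤ truncPrim K r := by
  unfold truncPrim
  rcases trunc_cases hK r with ⟨h1, h2⟩ | ⟨h1, h1', h2⟩ | ⟨h1, h2⟩ <;> rw [h2] <;> nlinarith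

/-! ### Growth of the weighted thermal stress -/

/-- Where `trunc K a` has not reached its maximal value, `f(trunc L (a + b))` grows at most like
the square root of `a`. -/
lemma exists_growth_bound {f : ℝ → ℝ} {a₀ M α C₀ K : ℝ} (hα : 1 / 2 < α) (hα' : α < 5 / 6)
    (ha₀ : 0 ≤ a₀) (hM : 0 ≤ M) (hf : ∀ r, |f r| ≤ a₀ + M * |r| ^ α)
    (hf_neg : ∀ r < 0, |f r| ≤ C₀ * (1 + |r|) ^ (1 / 2 : ℝ)) (hK : 0 < K) :
    ∃ C : ℝ, 0 < C ∧ ∀ L, 0 < L → ∀ a b,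
      (f (trunc L (a + b)) * (1 - trunc K a / K)) ^ 2 ≤ C * (1 + |a| + b ^ 2) := by
  obtain ⟨N, hN⟩ : ∃ N, N = a₀ + M * (1 + K) := ⟨_, rfl⟩
  have hN0 : 0 ≤ N := by rw [hN]; positivity
  -- The factor 4 bounds the squared weight. The bracket covers both signs of the argument of `f`,
  -- and the final 1 ensures positivity.
  refine ⟨4 * (2 * N ^ 2 + 2 * M ^ 2 + 2 * C₀ ^ 2) + 1, by positivity, fun L hL a b => ?_⟩
  have hb := sq_nonneg b
  have ha := abs_nonneg a
  -- For `K ≤ a` the weight is zero, so no growth condition on `f` is needed there.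
  rcases le_or_gt K a with hKa | hKa
  · rw [trunc_of_ge hKa, div_self hK.ne']
    rw [sub_self, mul_zero, zero_pow two_ne_zero]
    positivity
  have hw : (1 - trunc K a / K) ^ 2 ≤ 4 := by
    have h := abs_le.mp (abs_trunc_le hK.le a)
    have h1 : trunc K a / K ≤ 1 := by rw [div_le_one hK]; exact h.2
    have h2 : -1 ≤ trunc K a / K := by rw [le_div_iff₀ hK]; linarith
    nlinarith
  have hkey : f (trunc L (a + b)) ^ 2 ≤ (2 * N ^ 2 + 2 * M ^ 2 + 2 * C₀ ^ 2) * (1 + |a| + b ^ 2) := by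
    have hr : |trunc L (a + b)| ≤ |a + b| := by
      rcases trunc_cases hL.le (a + b) with ⟨h1, h2⟩ | ⟨h1, h1', h2⟩ | ⟨h1, h2⟩ <;> rw [h2]
      · rw [abs_neg, abs_of_pos hL]; exact (by linarith : L ≤ -(a + b)).trans (neg_le_abs _)
      · rw [abs_of_pos hL]; exact h1.trans (le_abs_self _)
    set r := trunc L (a + b) with hrdef
    rw [← sq_abs (f r)]
    rcases lt_or_ge r 0 with h0 | h0
    -- Negative argument: squaring the square root growth leaves a term linear in `|a| + |b|`.
    · have h1 := hf_neg r h0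
      have h2 : |f r| ^ 2 ≤ C₀ ^ 2 * (1 + |r|) := by
        calc |f r| ^ 2 ≤ (C₀ * (1 + |r|) ^ (1 / 2 : ℝ)) ^ 2 :=
              pow_le_pow_left₀ (abs_nonneg _) h1 2
          _ = C₀ ^ 2 * (1 + |r|) := by
              rw [mul_pow, ← Real.sqrt_eq_rpow, Real.sq_sqrt (by positivity)]
      have h3 : |r| ≤ |a| + |b| := hr.trans (abs_add_le a b)
      have h4 : |b| ≤ 1 + b ^ 2 := by nlinarith [sq_abs b, abs_nonneg b]
      have h5 : C₀ ^ 2 * (1 + |r|) ≤ 2 * C₀ ^ 2 * (1 + |a| + b ^ 2) := by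
        nlinarith [sq_nonneg C₀]
      have h6 : 0 ≤ (2 * N ^ 2 + 2 * M ^ 2) * (1 + |a| + b ^ 2) := by positivity
      linarith
    -- Nonnegative argument: since `a < K`, it is at most `K + |b|`, so the bound depends on `b`
    -- alone.
    · have h1 := hf r
      have h2 : |r| ≤ K + |b| := by
        rw [abs_of_nonneg h0]
        have : r ≤ max (a + b) (-L) := min_le_right _ _
        rcases le_max_iff.mp this with h | h
        · linarith [le_abs_self b]
        · linarith [abs_nonneg b]
      have h3 : |r| ^ α ≤ 1 + |r| := by
        calc |r| ^ α ≤ (1 + |r|) ^ α :=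
              Real.rpow_le_rpow (abs_nonneg _) (by linarith) (by linarith)
          _ ≤ (1 + |r|) ^ (1 : ℝ) :=
              Real.rpow_le_rpow_of_exponent_le (by linarith [abs_nonneg r]) (by linarith)
          _ = 1 + |r| := Real.rpow_one _
      have h4 : |f r| ≤ N + M * |b| := by
        have : M * |r| ^ α ≤ M * (1 + (K + |b|)) :=
          mul_le_mul_of_nonneg_left (by linarith) hM
        rw [hN]; linarith
      have h5 : |f r| ^ 2 ≤ 2 * N ^ 2 + 2 * M ^ 2 * b ^ 2 := by
        calc |f r| ^ 2 ≤ (N + M * |b|) ^ 2 := pow_le_pow_left₀ (abs_nonneg _) h4 2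
          _ ≤ 2 * N ^ 2 + 2 * M ^ 2 * b ^ 2 := by
              rw [← sq_abs b]; nlinarith [sq_nonneg (N - M * |b|)]
      have h6 : 0 ≤ C₀ ^ 2 * (1 + |a| + b ^ 2) := by positivity
      have h7 : 0 ≤ M ^ 2 * (1 + |a|) := by positivity
      have h8 : 0 ≤ N ^ 2 * (|a| + b ^ 2) := by positivity
      nlinarith
  rw [mul_pow]
  have h9 : 0 ≤ 1 + |a| + b ^ 2 := by positivity
  nlinarith [sq_nonneg (f (trunc L (a + b)))]

open Filter Topology ContinuousLinearMap
open scoped Convolution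

/-! ### Mollification -/

/-- A sequence of mollifiers supported in balls of radius `1 / (n + 1)`. -/
def bump (n : ℕ) : ContDiffBump (0 : E3) where
  rIn := 1 / (n + 1) / 2
  rOut := 1 / (n + 1)
  rIn_pos := by positivity
  rIn_lt_rOut := half_lt_self (by positivity)

lemma tendsto_bump_rOut : Tendsto (fun n => (bump n).rOut) atTop (𝓝 0) :=
  tendsto_one_div_add_atTop_nhds_zero_nat

/-- The mollification of a function at scale `1 / (n + 1)`. -/
def moll (n : ℕ) (f : E3 → ℝ) : E3 → ℝ :=
  (bump n).normed volume ⋆[lsmul ℝ ℝ, volume] f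

lemma integrable_bump (n : ℕ) : Integrable ((bump n).normed (volume : Measure E3)) :=
  (bump n).integrable_normed

lemma integrable_moll {f : E3 → ℝ} (hf : Integrable f) (n : ℕ) : Integrable (moll n f) :=
  (integrable_bump n).integrable_convolution _ hf

lemma integral_moll {f : E3 → ℝ} (hf : Integrable f) (n : ℕ) :
    ∫ x, moll n f x = ∫ x, f x := by
  unfold moll
  rw [integral_convolution _ (integrable_bump n) hf, (bump n).integral_normed]
  simp

lemma contDiff_moll {f : E3 → ℝ} (hf : LocallyIntegrable f) (n : ℕ) :
    ContDiff ℝ ((⊤ : ℕ∞) : WithTop ℕ∞) (moll n f) :=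
  (bump n).hasCompactSupport_normed.contDiff_convolution_left _ (bump n).contDiff_normed hf

lemma moll_apply (n : ℕ) (f : E3 → ℝ) (x : E3) :
    moll n f x = ∫ t, (bump n).normed volume (x - t) * f t := by
  unfold moll
  rw [convolution_eq_swap]
  rfl

lemma moll_add {f g : E3 → ℝ} (hf : LocallyIntegrable f) (hg : LocallyIntegrable g) (n : ℕ) :
    moll n (f + g) = moll n f + moll n g := by
  have h : ∀ {f : E3 → ℝ}, LocallyIntegrable f →
      ConvolutionExists ((bump n).normed volume) f (lsmul ℝ ℝ) volume := fun hf =>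
    (bump n).hasCompactSupport_normed.convolutionExists_left _ (bump n).continuous_normed hf
  exact (h hf).distrib_add (h hg)

lemma ae_tendsto_moll {f : E3 → ℝ} (hf : LocallyIntegrable f) :
    ∀ᵐ x, Tendsto (fun n => moll n f x) atTop (𝓝 (f x)) := by
  -- `K = 2` is the ratio `rOut / rIn` of the bumps. Its boundedness is what Lebesgue
  -- differentiation requires.
  refine ContDiffBump.ae_convolution_tendsto_right_of_locallyIntegrable (K := 2)
    tendsto_bump_rOut (Eventually.of_forall fun n => ?_) hf
  simp only [bump]
  linarith

/-- Scheffé's lemma for mollifications of a nonnegative function. -/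
lemma tendsto_integral_abs_moll_sub_of_nonneg {f : E3 → ℝ} (hf : Integrable f) (h0 : 0 ≤ f) :
    Tendsto (fun n => ∫ x, |moll n f x - f x|) atTop (𝓝 0) := by
  have hmoll : ∀ n x, 0 ≤ moll n f x := fun n x => by
    rw [moll_apply]
    exact integral_nonneg fun t => mul_nonneg ((bump n).nonneg_normed _) (h0 t)
  have hpos : ∀ n, Integrable fun x => max (f x - moll n f x) 0 := fun n =>
    (hf.sub (integrable_moll hf n)).pos_part
  -- Mollification preserves the integral, so the positive and negative parts of the difference have
  -- equal mass. Only $(f-f_n)_+$ must be estimated, where $f_n$ is `moll n f`, and it is dominated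
  -- by $f$ because $f_n\ge0$.
  have key : ∀ n, ∫ x, |moll n f x - f x| = 2 * ∫ x, max (f x - moll n f x) 0 := fun n => by
    have h1 : ∀ x, |moll n f x - f x| = (moll n f x - f x) + 2 * max (f x - moll n f x) 0 :=
      fun x => by
        rcases le_total (moll n f x) (f x) with h | h
        · rw [abs_of_nonpos (by linarith), max_eq_left (by linarith)]; ring
        · rw [abs_of_nonneg (by linarith), max_eq_right (by linarith)]; ring
    simp_rw [h1]
    have hs : Integrable fun x => moll n f x - f x := (integrable_moll hf n).sub hf
    rw [integral_add hs ((hpos n).const_mul 2), integral_sub (integrable_moll hf n) hf, integral_moll hf, sub_self, zero_add,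
      integral_const_mul]
  simp_rw [key]
  have : Tendsto (fun n => ∫ x, max (f x - moll n f x) 0) atTop (𝓝 (∫ _ : E3, (0 : ℝ))) := by
    refine tendsto_integral_of_dominated_convergence f (fun n => (hpos n).aestronglyMeasurable) hf
      (fun n => Eventually.of_forall fun x => ?_) ?_
    · rw [Real.norm_eq_abs, abs_of_nonneg (le_max_right _ _)]
      exact max_le (by linarith [hmoll n x]) (h0 x)
    · filter_upwards [ae_tendsto_moll hf.locallyIntegrable] with x hx
      have := (tendsto_const_nhds (x := f x)).sub hx |>.max (tendsto_const_nhds (x := (0 : ℝ)))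
      simpa using this
  simpa using this.const_mul 2

/-- Split into positive and negative parts. Writing the splitting as `p = f + q` makes additivity of
`moll` sufficient. -/
lemma tendsto_integral_abs_moll_sub {f : E3 → ℝ} (hf : Integrable f) :
    Tendsto (fun n => ∫ x, |moll n f x - f x|) atTop (𝓝 0) := by
  set p : E3 → ℝ := fun x => max (f x) 0
  set q : E3 → ℝ := fun x => max (-f x) 0
  have hp : Integrable p := hf.pos_part
  have hq : Integrable q := hf.neg_part
  have hpf : p = f + q := by
    funext x
    simp only [p, q, Pi.add_apply]
    rcases le_total (f x) 0 with h | h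
    · rw [max_eq_right h, max_eq_left (by linarith)]; ring
    · rw [max_eq_left h, max_eq_right (by linarith)]; ring
  have hsum := (tendsto_integral_abs_moll_sub_of_nonneg hp fun x => le_max_right _ _).add
    (tendsto_integral_abs_moll_sub_of_nonneg hq fun x => le_max_right _ _)
  rw [add_zero] at hsum
  refine squeeze_zero (fun n => integral_nonneg fun x => abs_nonneg _) (fun n => ?_) hsum
  have hs : ∀ {h : E3 → ℝ}, Integrable h → Integrable fun x => |moll n h x - h x| :=
    fun hh => ((integrable_moll hh n).sub hh).abs
  rw [← integral_add (hs hp) (hs hq)]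
  refine integral_mono (hs hf) ((hs hp).add (hs hq)) fun x => ?_
  have h1 : moll n p x = moll n f x + moll n q x := by
    rw [hpf, moll_add hf.locallyIntegrable hq.locallyIntegrable]; rfl
  have h2 : p x = f x + q x := congrFun hpf x
  calc |moll n f x - f x| = |(moll n p x - p x) - (moll n q x - q x)| := by
        rw [h1, h2]; congr 1; ring
    _ ≤ _ := abs_sub _ _

/-! ### Test functions -/

lemma IsTest.pderiv_continuous {Ω : Set E3} {φ : E3 → ℝ} (hφ : IsTest Ω φ) (i : Fin 3) :
    Continuous (pderiv i φ) :=
  (hφ.smooth.continuous_fderiv (by simp)).clm_apply continuous_const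

lemma support_pderiv_subset (φ : E3 → ℝ) (i : Fin 3) :
    Function.support (pderiv i φ) ⊆ tsupport φ := by
  intro x hx
  by_contra h
  refine hx ?_
  simp [pderiv, fderiv_of_notMem_tsupport ℝ h]

lemma IsTest.pderiv_hasCompactSupport {Ω : Set E3} {φ : E3 → ℝ} (hφ : IsTest Ω φ) (i : Fin 3) :
    HasCompactSupport (pderiv i φ) :=
  hφ.compact.of_isClosed_subset (isClosed_tsupport _)
    (closure_minimal (support_pderiv_subset φ i) (isClosed_tsupport _))

lemma IsTest.pderiv_eq_zero {Ω : Set E3} {φ : E3 → ℝ} (hφ : IsTest Ω φ) (i : Fin 3) {x : E3}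
    (hx : x ∉ Ω) : pderiv i φ x = 0 := by
  by_contra h
  exact hx (hφ.subset (support_pderiv_subset φ i h))

lemma IsTest.eq_zero {Ω : Set E3} {φ : E3 → ℝ} (hφ : IsTest Ω φ) {x : E3}
    (hx : x ∉ Ω) : φ x = 0 := by
  by_contra h
  exact hx (hφ.subset (subset_tsupport _ h))

/-! ### Chain rule for weak gradients -/

/-- The derivative of a mollification is the mollification of the weak gradient, away from the
boundary. -/
lemma pderiv_moll {Ω : Set E3} (hΩ : IsOpen Ω) {w : E3 → ℝ} {g : E3 → Fin 3 → ℝ}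
    (hw : IntegrableOn w Ω) (hwg : IsWeakGrad Ω w g) {n : ℕ} {x : E3}
    (hx : Metric.closedBall x (bump n).rOut ⊆ Ω) (i : Fin 3) :
    pderiv i (moll n (Ω.indicator w)) x = moll n (Ω.indicator fun y => g y i) x := by
  have hw' : Integrable (Ω.indicator w) := hw.integrable_indicator hΩ.measurableSet
  set ρ := (bump n).normed (volume : Measure E3) with hρdef
  have hρ : ContDiff ℝ ((⊤ : ℕ∞) : WithTop ℕ∞) ρ := (bump n).contDiff_normed
  have hρc : HasCompactSupport ρ := (bump n).hasCompactSupport_normed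
  have hder := hρc.hasFDerivAt_convolution_left (lsmul ℝ ℝ) (hρ.of_le (by simp))
    hw'.locallyIntegrable x
  have h1 : pderiv i (moll n (Ω.indicator w)) x
      = ∫ t, pderiv i ρ (x - t) * Ω.indicator w t := by
    unfold pderiv moll
    rw [hder.fderiv, convolution_eq_swap, ContinuousLinearMap.integral_apply]
    · rfl
    · have h := (hρc.fderiv ℝ).convolutionExists_left ((lsmul ℝ ℝ).precompL E3)
        (hρ.continuous_fderiv (by simp)) hw'.locallyIntegrable x
      exact h.integrable_swap
  -- The reflected kernel centred at `x` is an admissible test function because its support ball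
  -- lies in `Ω`. The reflection contributes the sign that cancels the one in the definition of the
  -- weak gradient.
  set ψ : E3 → ℝ := fun t => ρ (x - t) with hψdef
  have hψ : IsTest Ω ψ := by
    have hsub : tsupport ψ ⊆ Metric.closedBall x (bump n).rOut := by
      refine closure_minimal (fun t ht => ?_) Metric.isClosed_closedBall
      have : x - t ∈ Function.support ρ := ht
      rw [hρdef, (bump n).support_normed_eq, mem_ball_zero_iff] at this
      rw [Metric.mem_closedBall, dist_comm, dist_eq_norm]
      exact this.le
    refine ⟨hρ.comp (contDiff_const.sub contDiff_id), ?_, hsub.trans hx⟩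
    exact (isCompact_closedBall x (bump n).rOut).of_isClosed_subset (isClosed_tsupport _) hsub
  have hψd : ∀ t, pderiv i ψ t = - pderiv i ρ (x - t) := fun t => by
    have h := ((hρ.differentiable (by simp)) (x - t)).hasFDerivAt.comp t
      ((hasFDerivAt_const x t).sub (hasFDerivAt_id t))
    have h' : HasFDerivAt ψ _ t := h
    simp [pderiv, h'.fderiv]
  have h2 := hwg ψ hψ i
  rw [h1, moll_apply]
  calc ∫ t, pderiv i ρ (x - t) * Ω.indicator w t
      = ∫ t, Ω.indicator (fun t => -(w t * pderiv i ψ t)) t := by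
        refine integral_congr_ae (Eventually.of_forall fun t => ?_)
        by_cases ht : t ∈ Ω
        · simp only [indicator_of_mem ht, hψd]; ring
        · simp only [indicator_of_notMem ht, mul_zero]
    _ = ∫ t in Ω, g t i * ψ t := by
        rw [integral_indicator hΩ.measurableSet, integral_neg, h2, neg_neg]
    _ = ∫ t, ρ (x - t) * Ω.indicator (fun y => g y i) t := by
        rw [← integral_indicator hΩ.measurableSet]
        refine integral_congr_ae (Eventually.of_forall fun t => ?_)
        by_cases ht : t ∈ Ω
        · simp only [indicator_of_mem ht, hψdef]; ring
        · simp only [indicator_of_notMem ht, mul_zero]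

lemma tendsto_integral_mul_of_tendsto_L1 {μ : Measure E3} {f : ℕ → E3 → ℝ} {f₀ b : E3 → ℝ} {B : ℝ}
    (hf : ∀ n, Integrable (fun x => f n x * b x) μ) (hf₀ : Integrable (fun x => f₀ x * b x) μ)
    (hb : ∀ x, |b x| ≤ B) {d : ℕ → E3 → ℝ} (hd : ∀ n, Integrable (d n) μ)
    (hfd : ∀ n x, |f n x - f₀ x| ≤ d n x)
    (hlim : Tendsto (fun n => ∫ x, d n x ∂μ) atTop (𝓝 0)) :
    Tendsto (fun n => ∫ x, f n x * b x ∂μ) atTop (𝓝 (∫ x, f₀ x * b x ∂μ)) := by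
  rw [tendsto_iff_norm_sub_tendsto_zero]
  refine squeeze_zero (fun n => norm_nonneg _) (fun n => ?_) (by simpa using hlim.mul_const B)
  rw [← integral_sub (hf n) hf₀, ← integral_mul_const]
  refine norm_integral_le_of_norm_le ((hd n).mul_const B) (Eventually.of_forall fun x => ?_)
  rw [← sub_mul, norm_mul]
  exact mul_le_mul (hfd n x) (hb x) (norm_nonneg _) ((abs_nonneg _).trans (hfd n x))

/-- The chain rule for weak gradients and continuously differentiable functions with bounded
derivative. -/
lemma IsWeakGrad.comp {Ω : Set E3} (hΩ : IsOpen Ω) {w : E3 → ℝ} {g : E3 → Fin 3 → ℝ}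
    (hw : IntegrableOn w Ω) (hg : ∀ i, IntegrableOn (fun x => g x i) Ω) (hwg : IsWeakGrad Ω w g)
    {G G' : ℝ → ℝ} {B : ℝ} (hG : ∀ r, HasDerivAt G (G' r) r) (hG' : Continuous G')
    (hB : ∀ r, |G' r| ≤ B) :
    IsWeakGrad Ω (fun x => G (w x)) fun x i => G' (w x) * g x i := by
  intro φ hφ i
  have hΩm := hΩ.measurableSet
  set w' := Ω.indicator w
  set g' := Ω.indicator fun x => g x i
  have hw' : Integrable w' := hw.integrable_indicator hΩm
  have hg' : Integrable g' := (hg i).integrable_indicator hΩm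
  have hGd : Differentiable ℝ G := fun r => (hG r).differentiableAt
  have hB0 : 0 ≤ B := (abs_nonneg _).trans (hB 0)
  have hGlip : ∀ r s, |G r - G s| ≤ B * |r - s| := fun r s => by
    have := Convex.norm_image_sub_le_of_norm_hasDerivWithin_le (f := G) (f' := G') (s := univ)
      (C := B) (fun x _ => (hG x).hasDerivWithinAt) (fun x _ => hB x) convex_univ (mem_univ s)
      (mem_univ r)
    simpa using this
  have hφcont : Continuous φ := hφ.smooth.continuous
  have hdcont := hφ.pderiv_continuous i
  obtain ⟨M₁, hM₁⟩ := hdcont.bounded_above_of_compact_support (hφ.pderiv_hasCompactSupport i)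
  obtain ⟨M₂, hM₂⟩ := hφcont.bounded_above_of_compact_support hφ.compact
  have hWs : ∀ n, ContDiff ℝ ((⊤ : ℕ∞) : WithTop ℕ∞) (moll n w') :=
    fun n => contDiff_moll hw'.locallyIntegrable n
  have hgc : ∀ n, Continuous (moll n g') :=
    fun n => (contDiff_moll hg'.locallyIntegrable n).continuous
  -- convergence of the left sides
  have hleft : Tendsto (fun n => ∫ x, G (moll n w' x) * pderiv i φ x) atTop
      (𝓝 (∫ x, G (w' x) * pderiv i φ x)) := by
    refine tendsto_integral_mul_of_tendsto_L1 (B := M₁) (d := fun n x => B * |moll n w' x - w' x|)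
      (fun n => ?_) ?_ hM₁ (fun n => ((integrable_moll hw' n).sub hw').abs.const_mul B)
      (fun n x => hGlip _ _) ?_
    · exact ((hGd.continuous.comp (hWs n).continuous).mul hdcont).integrable_of_hasCompactSupport
        (hφ.pderiv_hasCompactSupport i).mul_left
    -- `G 0` may be nonzero, and then `G ∘ w'` is not integrable on the whole space. The constant is
    -- split off and paired with the compactly supported derivative.
    · have h1 : Integrable fun x => (G (w' x) - G 0) * pderiv i φ x := by
        refine Integrable.mono' (hw'.abs.const_mul (B * M₁))
          (((hGd.continuous.comp_aestronglyMeasurable hw'.aestronglyMeasurable).sub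
            aestronglyMeasurable_const).mul hdcont.aestronglyMeasurable)
          (Eventually.of_forall fun x => ?_)
        rw [norm_mul]
        have := hGlip (w' x) 0
        rw [sub_zero] at this
        calc _ ≤ (B * |w' x|) * M₁ := mul_le_mul this (hM₁ x) (norm_nonneg _) (by positivity)
          _ = _ := by ring
      have h2 : Integrable fun x => G 0 * pderiv i φ x :=
        (hdcont.integrable_of_hasCompactSupport (hφ.pderiv_hasCompactSupport i)).const_mul _
      refine (h1.add h2).congr (Eventually.of_forall fun x => ?_)
      simp only [Pi.add_apply]
      ring
    · simp_rw [integral_const_mul]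
      simpa using (tendsto_integral_abs_moll_sub hw').const_mul B
  -- convergence of the right sides
  have hfac : ∀ (v : E3 → ℝ), AEStronglyMeasurable v volume →
      AEStronglyMeasurable (fun x => G' (v x)) volume := fun v hv =>
    hG'.comp_aestronglyMeasurable hv
  have hIn : ∀ n, Integrable fun x => G' (moll n w' x) * (g' x * φ x) := fun n =>
    (hg'.mul_bdd (c := M₂) hφcont.aestronglyMeasurable (Eventually.of_forall hM₂)).bdd_mul (c := B)
      (hfac _ (integrable_moll hw' n).aestronglyMeasurable) (Eventually.of_forall fun x => hB _)
  have hJn : ∀ n, Integrable fun x => G' (moll n w' x) * (moll n g' x * φ x) := fun n =>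
    ((integrable_moll hg' n).mul_bdd (c := M₂) hφcont.aestronglyMeasurable
      (Eventually.of_forall hM₂)).bdd_mul (c := B)
      (hfac _ (integrable_moll hw' n).aestronglyMeasurable) (Eventually.of_forall fun x => hB _)
  -- `G' ∘ moll n w'` converges only almost everywhere and `moll n g'` only in $L^1$. The first
  -- limit is taken with `g'` fixed; the replacement error is then at most `B * M₂` times an $L^1$
  -- distance.
  have hright1 : Tendsto (fun n => ∫ x, G' (moll n w' x) * (g' x * φ x)) atTop
      (𝓝 (∫ x, G' (w' x) * (g' x * φ x))) := by
    refine tendsto_integral_of_dominated_convergence (fun x => B * |g' x * φ x|)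
      (fun n => (hIn n).aestronglyMeasurable)
      ((hg'.mul_bdd (c := M₂) hφcont.aestronglyMeasurable (Eventually.of_forall hM₂)).abs.const_mul B)
      (fun n => Eventually.of_forall fun x => ?_) ?_
    · rw [norm_mul]
      exact mul_le_mul_of_nonneg_right (hB _) (norm_nonneg _)
    · filter_upwards [ae_tendsto_moll hw'.locallyIntegrable] with x hx
      exact ((hG'.tendsto _).comp hx).mul_const _
  have hright2 : Tendsto (fun n => (∫ x, G' (moll n w' x) * (moll n g' x * φ x))
      - ∫ x, G' (moll n w' x) * (g' x * φ x)) atTop (𝓝 0) := by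
    rw [tendsto_zero_iff_norm_tendsto_zero]
    refine squeeze_zero (fun n => norm_nonneg _) (fun n => ?_)
      (by simpa using (tendsto_integral_abs_moll_sub hg').const_mul (B * M₂))
    rw [← integral_sub (hJn n) (hIn n), ← integral_const_mul]
    refine norm_integral_le_of_norm_le (((integrable_moll hg' n).sub hg').abs.const_mul _)
      (Eventually.of_forall fun x => ?_)
    rw [← mul_sub, ← sub_mul, norm_mul, norm_mul]
    calc ‖G' (moll n w' x)‖ * (‖moll n g' x - g' x‖ * ‖φ x‖)
        ≤ B * (‖moll n g' x - g' x‖ * M₂) :=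
          mul_le_mul (hB _) (mul_le_mul_of_nonneg_left (hM₂ x) (norm_nonneg _)) (by positivity) hB0
      _ = B * M₂ * |moll n g' x - g' x| := by rw [Real.norm_eq_abs]; ring
  have hright : Tendsto (fun n => -∫ x, G' (moll n w' x) * (moll n g' x * φ x)) atTop
      (𝓝 (-∫ x, G' (w' x) * (g' x * φ x))) := by
    have := (hright2.add hright1).neg
    simpa using this
  -- the identity for the mollified functions
  obtain ⟨δ, hδ, hsub⟩ := hφ.compact.isCompact.exists_cthickening_subset_open hΩ hφ.subset
  have hev : ∀ᶠ n in atTop, ∫ x, G (moll n w' x) * pderiv i φ x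
      = -∫ x, G' (moll n w' x) * (moll n g' x * φ x) := by
    filter_upwards [tendsto_bump_rOut.eventually_lt_const hδ] with n hn
    have hGW : ∀ x, HasFDerivAt (fun y => G (moll n w' y))
        (G' (moll n w' x) • fderiv ℝ (moll n w') x) x := fun x =>
      (hG _).comp_hasFDerivAt x (((hWs n).differentiable (by simp)) x).hasFDerivAt
    have hpd : ∀ x, fderiv ℝ (fun y => G (moll n w' y)) x (EuclideanSpace.single i 1) * φ x
        = G' (moll n w' x) * (moll n g' x * φ x) := fun x => by
      -- On the support of `φ` the mollification ball stays inside `Ω`, since its radius is below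
      -- `δ`. Elsewhere both sides vanish.
      by_cases hx : x ∈ tsupport φ
      · have hb : Metric.closedBall x (bump n).rOut ⊆ Ω :=
          ((Metric.closedBall_subset_closedBall hn.le).trans
            (Metric.closedBall_subset_cthickening hx δ)).trans hsub
        have := pderiv_moll hΩ hw hwg hb i
        rw [(hGW x).fderiv]
        simp only [_root_.smul_apply, smul_eq_mul]
        unfold pderiv at this
        rw [this, mul_assoc]
      · rw [image_eq_zero_of_notMem_tsupport hx]
        simp
    have := integral_mul_fderiv_eq_neg_fderiv_mul_of_integrable (μ := volume)
      (f := fun y => G (moll n w' y)) (g := φ) (v := EuclideanSpace.single i (1 : ℝ))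
      (by simp_rw [hpd]; exact hJn n)
      (((hGd.continuous.comp (hWs n).continuous).mul hdcont).integrable_of_hasCompactSupport
        (hφ.pderiv_hasCompactSupport i).mul_left)
      (((hGd.continuous.comp (hWs n).continuous).mul hφcont).integrable_of_hasCompactSupport
        hφ.compact.mul_left)
      (fun x _ => (hGW x).differentiableAt)
      (fun x _ => hφ.smooth.differentiable (by simp) x)
    simp_rw [hpd] at this
    exact this
  have hlim := tendsto_nhds_unique (hleft.congr' hev) hright
  have e1 : ∫ x in Ω, G (w x) * pderiv i φ x = ∫ x, G (w' x) * pderiv i φ x := by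
    rw [← integral_indicator hΩm]
    refine integral_congr_ae (Eventually.of_forall fun x => ?_)
    by_cases hx : x ∈ Ω
    · simp only [indicator_of_mem hx, w']
    · simp only [indicator_of_notMem hx, hφ.pderiv_eq_zero i hx, mul_zero]
  have e2 : ∫ x in Ω, G' (w x) * g x i * φ x = ∫ x, G' (w' x) * (g' x * φ x) := by
    rw [← integral_indicator hΩm]
    refine integral_congr_ae (Eventually.of_forall fun x => ?_)
    by_cases hx : x ∈ Ω
    · simp only [indicator_of_mem hx, w', g', mul_assoc]
    · simp only [indicator_of_notMem hx, hφ.eq_zero hx, mul_zero]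
  rw [e1, e2, hlim]

/-! ### Truncation of Sobolev functions -/

/-- The derivative of the truncation (with value `1/2` at `± K`). -/
def truncDeriv (K r : ℝ) : ℝ := (Real.sign (r + K) - Real.sign (r - K)) / 2

lemma measurable_real_sign : Measurable Real.sign := by
  unfold Real.sign
  exact Measurable.ite measurableSet_Iio measurable_const
    (Measurable.ite measurableSet_Ioi measurable_const measurable_const)

lemma measurable_truncDeriv (K : ℝ) : Measurable (truncDeriv K) := by
  unfold truncDeriv
  exact ((measurable_real_sign.comp (measurable_id.add_const K)).sub
    (measurable_real_sign.comp (measurable_id.sub_const K))).div_const 2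

lemma truncDeriv_nonneg {K : ℝ} (hK : 0 ≤ K) (r : ℝ) : 0 ≤ truncDeriv K r := by
  unfold truncDeriv
  rcases lt_trichotomy (r + K) 0 with h | h | h <;> rcases lt_trichotomy (r - K) 0 with h' | h' | h' <;>
  simp [h, h', Real.sign_of_neg, Real.sign_of_pos] <;> linarith

lemma truncDeriv_le_one (K r : ℝ) : truncDeriv K r ≤ 1 := by
  unfold truncDeriv
  rcases Real.sign_apply_eq (r + K) with h | h | h <;>
  rcases Real.sign_apply_eq (r - K) with h' | h' | h' <;> rw [h, h'] <;> norm_num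

/-- A smooth approximation of the truncation. -/
def smoothTrunc (K d r : ℝ) : ℝ := (√((r + K) ^ 2 + d ^ 2) - √((r - K) ^ 2 + d ^ 2)) / 2

/-- The derivative of `smoothTrunc`. -/
def smoothTruncDeriv (K d r : ℝ) : ℝ :=
  ((r + K) / √((r + K) ^ 2 + d ^ 2) - (r - K) / √((r - K) ^ 2 + d ^ 2)) / 2

lemma hasDerivAt_smoothTrunc (K : ℝ) {d : ℝ} (hd : 0 < d) (r : ℝ) :
    HasDerivAt (smoothTrunc K d) (smoothTruncDeriv K d r) r := by
  have h : ∀ c : ℝ, HasDerivAt (fun r : ℝ => √((r + c) ^ 2 + d ^ 2))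
      ((r + c) / √((r + c) ^ 2 + d ^ 2)) r := fun c => by
    have h1 : HasDerivAt (fun r : ℝ => (r + c) ^ 2 + d ^ 2) (2 * (r + c)) r := by
      simpa using (((hasDerivAt_id r).add_const c).pow 2).add_const (d ^ 2)
    convert h1.sqrt (by positivity) using 1
    rw [mul_div_mul_left _ _ two_ne_zero]
  have h2 := ((h K).fun_sub (h (-K))).div_const 2
  simp only [← sub_eq_add_neg] at h2
  exact h2

lemma continuous_smoothTruncDeriv (K : ℝ) {d : ℝ} (hd : 0 < d) :
    Continuous (smoothTruncDeriv K d) := by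
  have h : ∀ c : ℝ, Continuous fun r : ℝ => (r + c) / √((r + c) ^ 2 + d ^ 2) := fun c => by
    refine Continuous.div (by fun_prop) (by fun_prop) fun r => ?_
    have : 0 < √((r + c) ^ 2 + d ^ 2) := Real.sqrt_pos.mpr (by positivity)
    exact this.ne'
  have h2 := ((h K).fun_sub (h (-K))).div_const 2
  simp only [← sub_eq_add_neg] at h2
  exact h2

lemma abs_le_sqrt_sq_add (x d : ℝ) : |x| ≤ √(x ^ 2 + d ^ 2) := by
  rw [← Real.sqrt_sq_eq_abs]
  exact Real.sqrt_le_sqrt (by nlinarith [sq_nonneg d])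

lemma abs_smoothTruncDeriv_le (K d r : ℝ) : |smoothTruncDeriv K d r| ≤ 1 := by
  have h : ∀ x : ℝ, |x / √(x ^ 2 + d ^ 2)| ≤ 1 := fun x => by
    rw [abs_div, abs_of_nonneg (Real.sqrt_nonneg _)]
    exact div_le_one_of_le₀ (abs_le_sqrt_sq_add x d) (Real.sqrt_nonneg _)
  have h1 := abs_le.mp (h (r + K))
  have h2 := abs_le.mp (h (r - K))
  unfold smoothTruncDeriv
  rw [abs_le]
  constructor <;> linarith [h1.1, h1.2, h2.1, h2.2]

lemma abs_smoothTrunc_le {K d : ℝ} (hK : 0 ≤ K) (hd : 0 ≤ d) (hd' : d ≤ 1) (r : ℝ) :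
    |smoothTrunc K d r| ≤ |r| + (K + 1) := by
  have h : ∀ x : ℝ, √(x ^ 2 + d ^ 2) ≤ |x| + 1 := fun x => by
    rw [Real.sqrt_le_left (by positivity)]
    nlinarith [sq_abs x, abs_nonneg x]
  have h1 := h (r + K)
  have h2 := h (r - K)
  have h3 : |r + K| ≤ |r| + K := (abs_add_le r K).trans (by rw [abs_of_nonneg hK])
  have h4 : |r - K| ≤ |r| + K := (abs_sub r K).trans (by rw [abs_of_nonneg hK])
  have h5 := Real.sqrt_nonneg ((r + K) ^ 2 + d ^ 2)
  have h6 := Real.sqrt_nonneg ((r - K) ^ 2 + d ^ 2)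
  unfold smoothTrunc
  rw [abs_le]
  constructor <;> linarith [abs_nonneg r]

lemma tendsto_smoothTrunc {K : ℝ} (hK : 0 ≤ K) {d : ℕ → ℝ} (hd : Tendsto d atTop (𝓝 0)) (r : ℝ) :
    Tendsto (fun n => smoothTrunc K (d n) r) atTop (𝓝 (trunc K r)) := by
  have hc : Continuous fun s : ℝ => smoothTrunc K s r := by
    unfold smoothTrunc; fun_prop
  have := (hc.tendsto 0).comp hd
  have h0 : smoothTrunc K 0 r = trunc K r := by
    rw [trunc_eq_abs hK, smoothTrunc]
    simp [Real.sqrt_sq_eq_abs]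
  rwa [h0] at this

/-- At `x = 0` every quotient is 0, which is also `Real.sign 0`. This fixes the value of
`truncDeriv` at the kinks. -/
lemma tendsto_div_sqrt {d : ℕ → ℝ} (hd : Tendsto d atTop (𝓝 0)) (x : ℝ) :
    Tendsto (fun n => x / √(x ^ 2 + d n ^ 2)) atTop (𝓝 (Real.sign x)) := by
  rcases eq_or_ne x 0 with rfl | hx
  · simp
  have hc : Tendsto (fun n => √(x ^ 2 + d n ^ 2)) atTop (𝓝 |x|) := by
    have hc : Continuous fun s : ℝ => √(x ^ 2 + s ^ 2) := by fun_prop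
    have := (hc.tendsto 0).comp hd
    simpa [Real.sqrt_sq_eq_abs, Function.comp_def] using this
  have h := (tendsto_const_nhds (x := x)).div hc (abs_ne_zero.mpr hx)
  have : x / |x| = Real.sign x := by
    rcases lt_or_gt_of_ne hx with h | h
    · rw [abs_of_neg h, Real.sign_of_neg h, div_neg, div_self hx]
    · rw [abs_of_pos h, Real.sign_of_pos h, div_self hx]
  rwa [this] at h

lemma tendsto_smoothTruncDeriv (K : ℝ) {d : ℕ → ℝ} (hd : Tendsto d atTop (𝓝 0)) (r : ℝ) :
    Tendsto (fun n => smoothTruncDeriv K (d n) r) atTop (𝓝 (truncDeriv K r)) :=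
  ((tendsto_div_sqrt hd (r + K)).sub (tendsto_div_sqrt hd (r - K))).div_const 2

lemma isFiniteMeasure_bulk {Ω : Set E3} (hΩ : Bornology.IsBounded Ω) :
    IsFiniteMeasure (bulk Ω) :=
  ⟨by rw [Measure.restrict_apply_univ]; exact hΩ.measure_lt_top⟩

lemma IsTest.exists_bound {Ω : Set E3} {φ : E3 → ℝ} (hφ : IsTest Ω φ) : ∃ M, ∀ x, |φ x| ≤ M :=
  hφ.smooth.continuous.bounded_above_of_compact_support hφ.compact

lemma IsTest.exists_pderiv_bound {Ω : Set E3} {φ : E3 → ℝ} (hφ : IsTest Ω φ) (i : Fin 3) :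
    ∃ M, ∀ x, |pderiv i φ x| ≤ M :=
  (hφ.pderiv_continuous i).bounded_above_of_compact_support (hφ.pderiv_hasCompactSupport i)

/-- Apply the chain rule to `smoothTrunc` and pass to the limit by dominated convergence. The
derivatives converge at every point, kinks included, so it need not be known that the gradient
vanishes on level sets. -/
lemma MemH1.trunc {Ω : Set E3} (hΩ : IsOpen Ω) (hb : Bornology.IsBounded Ω) {w : E3 → ℝ}
    {g : E3 → Fin 3 → ℝ} (h : MemH1 Ω w g) {K : ℝ} (hK : 0 ≤ K) :
    MemH1 Ω (fun x => trunc K (w x)) fun x i => truncDeriv K (w x) * g x i := by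
  have := isFiniteMeasure_bulk hb
  have hwm := h.memLp.aestronglyMeasurable
  have hwi : Integrable w (bulk Ω) := h.memLp.integrable (by norm_num)
  have hgi : ∀ i, Integrable (fun x => g x i) (bulk Ω) :=
    fun i => (h.grad_memLp i).integrable (by norm_num)
  have hdm : AEStronglyMeasurable (fun x => truncDeriv K (w x)) (bulk Ω) :=
    ((measurable_truncDeriv K).comp_aemeasurable hwm.aemeasurable).aestronglyMeasurable
  refine ⟨?_, fun i => ?_, ?_⟩
  · exact MemLp.of_bound ((continuous_trunc K).comp_aestronglyMeasurable hwm) K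
      (Eventually.of_forall fun x => abs_trunc_le hK _)
  · refine (h.grad_memLp i).mono (hdm.mul (h.grad_memLp i).aestronglyMeasurable)
      (Eventually.of_forall fun x => ?_)
    rw [norm_mul, Real.norm_eq_abs, abs_of_nonneg (truncDeriv_nonneg hK _)]
    exact mul_le_of_le_one_left (norm_nonneg _) (truncDeriv_le_one K _)
  · intro φ hφ i
    set d : ℕ → ℝ := fun n => 1 / ((n : ℝ) + 1)
    have hd0 : ∀ n, 0 < d n := fun n => by positivity
    have hd1 : ∀ n, d n ≤ 1 := fun n => by
      rw [div_le_one (by positivity)]; linarith [(n.cast_nonneg : (0 : ℝ) ≤ n)]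
    have hd : Tendsto d atTop (𝓝 0) := tendsto_one_div_add_atTop_nhds_zero_nat
    obtain ⟨M₁, hM₁⟩ := hφ.exists_pderiv_bound i
    obtain ⟨M₂, hM₂⟩ := hφ.exists_bound
    have hM₂0 : 0 ≤ M₂ := (abs_nonneg _).trans (hM₂ 0)
    have hφm := hφ.smooth.continuous.aestronglyMeasurable (μ := bulk Ω)
    have hdφm := (hφ.pderiv_continuous i).aestronglyMeasurable (μ := bulk Ω)
    have hid : ∀ n, ∫ x in Ω, smoothTrunc K (d n) (w x) * pderiv i φ x
        = -∫ x in Ω, smoothTruncDeriv K (d n) (w x) * g x i * φ x := fun n =>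
      IsWeakGrad.comp hΩ hwi hgi h.weakGrad (hasDerivAt_smoothTrunc K (hd0 n))
        (continuous_smoothTruncDeriv K (hd0 n)) (abs_smoothTruncDeriv_le K (d n)) φ hφ i
    have hl : Tendsto (fun n => ∫ x in Ω, smoothTrunc K (d n) (w x) * pderiv i φ x) atTop
        (𝓝 (∫ x in Ω, ThermoPlasticity.trunc K (w x) * pderiv i φ x)) := by
      refine tendsto_integral_of_dominated_convergence (fun x => (|w x| + (K + 1)) * M₁)
        (fun n => ?_) ((hwi.abs.add (integrable_const _)).mul_const _)
        (fun n => Eventually.of_forall fun x => ?_)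
        (Eventually.of_forall fun x => (tendsto_smoothTrunc hK hd _).mul_const _)
      · have hc : Continuous (smoothTrunc K (d n)) := by unfold smoothTrunc; fun_prop
        exact (hc.comp_aestronglyMeasurable hwm).mul hdφm
      · rw [norm_mul]
        exact mul_le_mul (abs_smoothTrunc_le hK (hd0 n).le (hd1 n) _) (hM₁ x) (norm_nonneg _)
          (by positivity)
    have hr : Tendsto (fun n => -∫ x in Ω, smoothTruncDeriv K (d n) (w x) * g x i * φ x) atTop
        (𝓝 (-∫ x in Ω, truncDeriv K (w x) * g x i * φ x)) := by
      refine (tendsto_integral_of_dominated_convergence (fun x => |g x i| * M₂)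
        (fun n => ?_) ((hgi i).abs.mul_const _) (fun n => Eventually.of_forall fun x => ?_)
        (Eventually.of_forall fun x =>
          ((tendsto_smoothTruncDeriv K hd _).mul_const _).mul_const _)).neg
      · exact (((continuous_smoothTruncDeriv K (hd0 n)).comp_aestronglyMeasurable hwm).mul
          (hgi i).aestronglyMeasurable).mul hφm
      · rw [norm_mul, norm_mul]
        refine mul_le_mul ?_ (hM₂ x) (norm_nonneg _) (abs_nonneg _)
        exact mul_le_of_le_one_left (norm_nonneg _) (abs_smoothTruncDeriv_le _ _ _)
    exact tendsto_nhds_unique (hl.congr hid) hr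

/-! ### Uniqueness of weak gradients -/

/-- The fundamental lemma of the calculus of variations. It identifies $\nabla u(0)$ with $\nabla
u_0$, which makes the initial energy independent of the solution and of `lam`. -/
lemma IsWeakGrad.ae_eq {Ω : Set E3} (hΩ : IsOpen Ω) {w w' : E3 → ℝ} {g g' : E3 → Fin 3 → ℝ}
    (hw : IsWeakGrad Ω w g) (hw' : IsWeakGrad Ω w' g') (h : w =ᵐ[bulk Ω] w')
    (hg : ∀ i, IntegrableOn (fun x => g x i) Ω) (hg' : ∀ i, IntegrableOn (fun x => g' x i) Ω)
    (i : Fin 3) : (fun x => g x i) =ᵐ[bulk Ω] fun x => g' x i := by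
  have hint : IntegrableOn (fun x => g x i - g' x i) Ω := (hg i).sub (hg' i)
  have h0 := hΩ.ae_eq_zero_of_integral_contDiff_smul_eq_zero hint.locallyIntegrableOn
    fun φ hφ hφc hφΩ => by
      have ht : IsTest Ω φ := ⟨hφ, hφc, hφΩ⟩
      obtain ⟨M, hM⟩ := ht.exists_bound
      have e1 : ∫ x in Ω, w x * pderiv i φ x = ∫ x in Ω, w' x * pderiv i φ x :=
        integral_congr_ae (h.mono fun x hx => by simp only [hx])
      rw [hw φ ht i, hw' φ ht i, neg_inj] at e1
      have hφm := hφ.continuous.aestronglyMeasurable (μ := bulk Ω)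
      have i1 : Integrable (fun x => g x i * φ x) (bulk Ω) :=
        (hg i).mul_bdd (c := M) hφm (Eventually.of_forall hM)
      have i2 : Integrable (fun x => g' x i * φ x) (bulk Ω) :=
        (hg' i).mul_bdd (c := M) hφm (Eventually.of_forall hM)
      have e2 : ∫ x in Ω, (g x i * φ x - g' x i * φ x) = 0 := by
        rw [integral_sub i1 i2, e1, sub_self]
      rw [← e2, ← integral_indicator hΩ.measurableSet]
      refine integral_congr_ae (Eventually.of_forall fun x => ?_)
      by_cases hx : x ∈ Ω
      · simp only [indicator_of_mem hx, smul_eq_mul]; ring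
      · simp only [indicator_of_notMem hx, ht.eq_zero hx, zero_smul]
  refine (ae_restrict_iff' hΩ.measurableSet).mpr (h0.mono fun x hx hxΩ => ?_)
  exact sub_eq_zero.mp (hx hxΩ)

/-! ### Functions vanishing at the boundary -/

/-- Continuity of the $L^2$ inner product. -/
lemma tendsto_integral_mul_of_tendsto_L2 {α : Type*} [MeasurableSpace α] {μ : Measure α}
    {f b : ℕ → α → ℝ} {f₀ b₀ : α → ℝ} (hf : ∀ n, MemLp (f n) 2 μ) (hf₀ : MemLp f₀ 2 μ)
    (hb : ∀ n, MemLp (b n) 2 μ) (hb₀ : MemLp b₀ 2 μ)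
    (hff : Tendsto (fun n => eLpNorm (f n - f₀) 2 μ) atTop (𝓝 0))
    (hbb : Tendsto (fun n => eLpNorm (b n - b₀) 2 μ) atTop (𝓝 0)) :
    Tendsto (fun n => ∫ x, f n x * b n x ∂μ) atTop (𝓝 (∫ x, f₀ x * b₀ x ∂μ)) := by
  have key : ∀ {u v : α → ℝ} (hu : MemLp u 2 μ) (hv : MemLp v 2 μ),
      inner ℝ (hu.toLp u) (hv.toLp v) = ∫ x, u x * v x ∂μ := fun hu hv => by
    rw [L2.inner_def]
    refine integral_congr_ae ?_
    filter_upwards [hu.coeFn_toLp, hv.coeFn_toLp] with x h1 h2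
    rw [h1, h2]
    simp [mul_comm]
  have h1 := (Lp.tendsto_Lp_iff_tendsto_eLpNorm'' f hf f₀ hf₀).mpr hff
  have h2 := (Lp.tendsto_Lp_iff_tendsto_eLpNorm'' b hb b₀ hb₀).mpr hbb
  have := h1.inner (𝕜 := ℝ) h2
  simpa only [key] using this

section L2

variable {α : Type*} [MeasurableSpace α] {μ : Measure α}

lemma integrable_mul_of_memLp {f g : α → ℝ} (hf : MemLp f 2 μ) (hg : MemLp g 2 μ) :
    Integrable (fun x => f x * g x) μ :=
  hf.integrable_mul hg

lemma integrable_ddot {A B : α → Mat3} (hA : ∀ i j, MemLp (fun x => A x i j) 2 μ)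
    (hB : ∀ i j, MemLp (fun x => B x i j) 2 μ) : Integrable (fun x => ddot (A x) (B x)) μ :=
  integrable_finsetSum _ fun i _ => integrable_finsetSum _ fun j _ =>
    integrable_mul_of_memLp (hA i j) (hB i j)

lemma integral_ddot {A B : α → Mat3} (hA : ∀ i j, MemLp (fun x => A x i j) 2 μ)
    (hB : ∀ i j, MemLp (fun x => B x i j) 2 μ) :
    ∫ x, ddot (A x) (B x) ∂μ = ∑ i, ∑ j, ∫ x, A x i j * B x i j ∂μ := by
  unfold ddot
  rw [integral_finsetSum _ fun i _ => integrable_finsetSum _ fun j _ =>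
    integrable_mul_of_memLp (hA i j) (hB i j)]
  exact Finset.sum_congr rfl fun i _ =>
    integral_finsetSum _ fun j _ => integrable_mul_of_memLp (hA i j) (hB i j)

end L2

lemma IsTest.memLp {Ω : Set E3} {φ : E3 → ℝ} (hφ : IsTest Ω φ) (μ : Measure E3)
    [IsFiniteMeasureOnCompacts μ] : MemLp φ 2 μ :=
  hφ.smooth.continuous.memLp_of_hasCompactSupport hφ.compact

lemma IsTest.pderiv_memLp {Ω : Set E3} {φ : E3 → ℝ} (hφ : IsTest Ω φ) (i : Fin 3)
    (μ : Measure E3) [IsFiniteMeasureOnCompacts μ] : MemLp (pderiv i φ) 2 μ :=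
  (hφ.pderiv_continuous i).memLp_of_hasCompactSupport (hφ.pderiv_hasCompactSupport i)

lemma MemH10.exists_seq {Ω : Set E3} {w : E3 → ℝ} {g : E3 → Fin 3 → ℝ} (h : MemH10 Ω w g) :
    ∃ φ : ℕ → E3 → ℝ, (∀ n, IsTest Ω (φ n)) ∧
      Tendsto (fun n => eLpNorm (φ n - w) 2 (bulk Ω)) atTop (𝓝 0) ∧
      ∀ i, Tendsto (fun n => eLpNorm (pderiv i (φ n) - fun x => g x i) 2 (bulk Ω)) atTop (𝓝 0) := by
  choose φ hφ h1 h2 using fun n : ℕ => h.approx ((n : ENNReal) + 1)⁻¹ (by simp)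
  have hlim : Tendsto (fun n : ℕ => ((n : ENNReal) + 1)⁻¹) atTop (𝓝 0) := by
    have := (tendsto_add_atTop_iff_nat 1).mpr ENNReal.tendsto_inv_nat_nhds_zero
    simpa using this
  refine ⟨φ, hφ, ?_, fun i => ?_⟩
  · refine tendsto_of_tendsto_of_tendsto_of_le_of_le tendsto_const_nhds hlim
      (fun _ => zero_le) fun n => ?_
    rw [eLpNorm_sub_comm]
    exact h1 n
  · refine tendsto_of_tendsto_of_tendsto_of_le_of_le tendsto_const_nhds hlim
      (fun _ => zero_le) fun n => ?_
    rw [eLpNorm_sub_comm]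
    exact h2 n i

/-- The Poincaré inequality in one direction, for test functions. -/
lemma IsTest.poincare {Ω : Set E3} {R : ℝ} (hR : ∀ x ∈ Ω, ‖x‖ ≤ R)
    {φ : E3 → ℝ} (hφ : IsTest Ω φ) (i : Fin 3) :
    ∫ x, φ x * φ x ≤ 4 * R ^ 2 * ∫ x, pderiv i φ x * pderiv i φ x := by
  have hφc := hφ.smooth.continuous
  have hdc := hφ.pderiv_continuous i
  have hcoord : Continuous fun x : E3 => x i := by fun_prop
  set L : E3 →L[ℝ] ℝ := EuclideanSpace.proj i with hL
  have hLi : ∀ x : E3, L x = x i := fun x => rfl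
  have hsq : ∀ x, fderiv ℝ (fun y => φ y * φ y) x (EuclideanSpace.single i 1)
      = 2 * φ x * pderiv i φ x := fun x => by
    have hd := (hφ.smooth.differentiable (by simp) x).hasFDerivAt
    rw [(hd.fun_mul hd).fderiv]
    simp only [_root_.add_apply, _root_.smul_apply, smul_eq_mul, pderiv]
    ring
  have hs2 : HasCompactSupport fun x => φ x * φ x := hφ.compact.mul_left
  have hA : ∀ x, fderiv ℝ L x (EuclideanSpace.single i 1) = 1 := fun x => by
    rw [L.fderiv, hLi]; simp
  -- Integrating by parts with the coordinate function gives $\int\varphi^2=-2\int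
  -- x_i\,\varphi\,\partial_i\varphi$.
  have ibp := integral_mul_fderiv_eq_neg_fderiv_mul_of_integrable (μ := (volume : Measure E3))
    (f := L) (g := fun y => φ y * φ y) (v := EuclideanSpace.single i (1 : ℝ))
    (by simp_rw [hA, one_mul]; exact (hφc.mul hφc).integrable_of_hasCompactSupport hs2)
    (by
      simp_rw [hsq]
      refine Continuous.integrable_of_hasCompactSupport (by fun_prop) ?_
      exact HasCompactSupport.mul_left (HasCompactSupport.mul_left (hφ.pderiv_hasCompactSupport i)))
    (Continuous.integrable_of_hasCompactSupport (by fun_prop) hs2.mul_left)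
    (fun x _ => L.differentiableAt)
    (fun x _ => (hφ.smooth.differentiable (by simp) x).mul (hφ.smooth.differentiable (by simp) x))
  simp_rw [hsq, hA, one_mul] at ibp
  have i1 : Integrable fun x => φ x * φ x := (hφc.mul hφc).integrable_of_hasCompactSupport hs2
  have i2 : Integrable fun x => pderiv i φ x * pderiv i φ x :=
    (hdc.mul hdc).integrable_of_hasCompactSupport (hφ.pderiv_hasCompactSupport i).mul_left
  have h1 : ∫ x, φ x * φ x = ∫ x, -(L x * (2 * φ x * pderiv i φ x)) := by
    rw [integral_neg, ibp, neg_neg]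
  -- Young's inequality with $|x_i|\le R$ on `Ω`. The term $\frac12\int\varphi^2$ is absorbed at the
  -- end, which produces the constant $4R^2$.
  have h2 : ∫ x, -(L x * (2 * φ x * pderiv i φ x))
      ≤ ∫ x, (1 / 2 * (φ x * φ x) + 2 * R ^ 2 * (pderiv i φ x * pderiv i φ x)) := by
    refine integral_mono (Continuous.integrable_of_hasCompactSupport (by fun_prop)
      (HasCompactSupport.mul_left (HasCompactSupport.mul_left
        (hφ.pderiv_hasCompactSupport i))).neg) ((i1.const_mul _).add (i2.const_mul _)) fun x => ?_
    by_cases hx : x ∈ Ω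
    · have hxR : |L x| ≤ R := by
        rw [hLi]
        exact (PiLp.norm_apply_le x i).trans (hR x hx)
      have hsq : L x ^ 2 ≤ R ^ 2 := sq_le_sq' (abs_le.mp hxR).1 (abs_le.mp hxR).2
      have := mul_le_mul_of_nonneg_right hsq (sq_nonneg (pderiv i φ x))
      simp only
      nlinarith [sq_nonneg (φ x + 2 * L x * pderiv i φ x)]
    · simp only [hφ.eq_zero hx, hφ.pderiv_eq_zero i hx]
      simp
  rw [integral_add (i1.const_mul _) (i2.const_mul _), integral_const_mul, integral_const_mul] at h2
  linarith

/-- The Poincaré inequality in one direction. -/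
lemma MemH10.poincare {Ω : Set E3} {R : ℝ} (hR : ∀ x ∈ Ω, ‖x‖ ≤ R)
    {w : E3 → ℝ} {g : E3 → Fin 3 → ℝ} (h : MemH10 Ω w g) (i : Fin 3) :
    ∫ x in Ω, w x ^ 2 ≤ 4 * R ^ 2 * ∫ x in Ω, g x i ^ 2 := by
  obtain ⟨φ, hφ, h1, h2⟩ := h.exists_seq
  have t1 := tendsto_integral_mul_of_tendsto_L2 (fun n => (hφ n).memLp _) h.memH1.memLp
    (fun n => (hφ n).memLp _) h.memH1.memLp h1 h1
  have t2 := tendsto_integral_mul_of_tendsto_L2 (fun n => (hφ n).pderiv_memLp i _)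
    (h.memH1.grad_memLp i) (fun n => (hφ n).pderiv_memLp i _) (h.memH1.grad_memLp i) (h2 i) (h2 i)
  simp_rw [sq (w _), sq (g _ i)]
  refine le_of_tendsto_of_tendsto' t1 (t2.const_mul _) fun n => ?_
  rw [setIntegral_eq_integral_of_forall_compl_eq_zero fun x hx => by simp [(hφ n).eq_zero hx],
    setIntegral_eq_integral_of_forall_compl_eq_zero
      fun x hx => by simp [(hφ n).pderiv_eq_zero i hx]]
  exact (hφ n).poincare hR i

/-- A distributional identity for the divergence of a square integrable matrix field may be tested
with functions that vanish at the boundary. -/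
lemma integral_ddot_eq_of_forall_test {Ω : Set E3} {S : E3 → Mat3} {F : E3 → Fin 3 → ℝ}
    (hS : ∀ i j, MemLp (fun x => S x i j) 2 (bulk Ω)) (hF : ∀ i, MemLp (fun x => F x i) 2 (bulk Ω))
    (h : ∀ φ : Fin 3 → E3 → ℝ, (∀ i, IsTest Ω (φ i)) →
      ∫ x in Ω, ddot (S x) (Matrix.of fun i j => pderiv j (φ i) x) = ∫ x in Ω, ∑ i, F x i * φ i x)
    {u : E3 → Fin 3 → ℝ} {G : E3 → Mat3}
    (hu : ∀ i, MemH10 Ω (fun x => u x i) fun x j => G x i j) :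
    ∫ x in Ω, ddot (S x) (G x) = ∫ x in Ω, ∑ i, F x i * u x i := by
  choose φ hφ h1 h2 using fun i => (hu i).exists_seq
  have hz : ∀ {f : E3 → ℝ}, Tendsto (fun _ : ℕ => eLpNorm (f - f) 2 (bulk Ω)) atTop (𝓝 0) := by
    simp
  have tl : Tendsto (fun n => ∑ i, ∑ j, ∫ x in Ω, S x i j * pderiv j (φ i n) x) atTop
      (𝓝 (∑ i, ∑ j, ∫ x in Ω, S x i j * G x i j)) :=
    tendsto_finsetSum _ fun i _ => tendsto_finsetSum _ fun j _ =>
      tendsto_integral_mul_of_tendsto_L2 (fun _ => hS i j) (hS i j)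
        (fun n => (hφ i n).pderiv_memLp j _) ((hu i).memH1.grad_memLp j) hz (h2 i j)
  have tr : Tendsto (fun n => ∑ i, ∫ x in Ω, F x i * φ i n x) atTop
      (𝓝 (∑ i, ∫ x in Ω, F x i * u x i)) :=
    tendsto_finsetSum _ fun i _ =>
      tendsto_integral_mul_of_tendsto_L2 (fun _ => hF i) (hF i)
        (fun n => (hφ i n).memLp _) (hu i).memH1.memLp hz (h1 i)
  have er : ∀ {v : E3 → Fin 3 → ℝ}, (∀ i, MemLp (fun x => v x i) 2 (bulk Ω)) →
      ∫ x in Ω, ∑ i, F x i * v x i = ∑ i, ∫ x in Ω, F x i * v x i := fun hv =>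
    integral_finsetSum _ fun i _ => (hF i).integrable_mul (hv i)
  rw [integral_ddot hS fun i j => (hu i).memH1.grad_memLp j, er fun i => (hu i).memH1.memLp]
  refine tendsto_nhds_unique tl (tr.congr fun n => ?_)
  rw [← er fun i => (hφ i n).memLp _, ← h (fun i => φ i n) fun i => hφ i n]
  exact integral_ddot (B := fun x => Matrix.of fun i j => pderiv j (φ i n) x) hS
    fun i j => (hφ i n).pderiv_memLp j _

/-! ### Absolutely continuous paths -/

section Path

variable {p q : ℝ → ℝ} {t : ℝ}

lemma absolutelyContinuous_primitive (hp : IntervalIntegrable p volume 0 t) (c : ℝ) :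
    AbsolutelyContinuousOnInterval (fun s => c + ∫ r in (0 : ℝ)..s, p r) 0 t := by
  refine (LipschitzOnWith.absolutelyContinuousOnInterval (K := 0) ?_).fun_add
    (hp.absolutelyContinuousOnInterval_intervalIntegral (c := 0) (by simp))
  exact fun x _ y _ => by simp

lemma ae_hasDerivAt_primitive (hp : IntervalIntegrable p volume 0 t) (c : ℝ) :
    ∀ᵐ s, s ∈ uIcc 0 t → HasDerivAt (fun s => c + ∫ r in (0 : ℝ)..s, p r) (p s) s := by
  filter_upwards [hp.ae_hasDerivAt_integral] with s hs hst
  exact (hs hst 0 (by simp)).const_add c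

lemma integral_primitive_mul (hp : IntervalIntegrable p volume 0 t)
    (hq : IntervalIntegrable q volume 0 t) (a b : ℝ) :
    ∫ s in (0 : ℝ)..t, (p s * (b + ∫ r in (0 : ℝ)..s, q r) + (a + ∫ r in (0 : ℝ)..s, p r) * q s)
      = (a + ∫ r in (0 : ℝ)..t, p r) * (b + ∫ r in (0 : ℝ)..t, q r) - a * b := by
  have h := (absolutelyContinuous_primitive hp a).integral_deriv_mul_eq_sub
    (absolutelyContinuous_primitive hq b)
  simp only [intervalIntegral.integral_same, add_zero] at h
  rw [← h]
  refine intervalIntegral.integral_congr_ae ?_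
  filter_upwards [ae_hasDerivAt_primitive hp a, ae_hasDerivAt_primitive hq b] with s h1 h2 hs
  rw [(h1 (uIoc_subset_uIcc hs)).deriv, (h2 (uIoc_subset_uIcc hs)).deriv]

lemma _root_.LipschitzWith.comp_absolutelyContinuousOnInterval {G f : ℝ → ℝ} {L : NNReal}
    (hG : LipschitzWith L G) {a b : ℝ} (hf : AbsolutelyContinuousOnInterval f a b) :
    AbsolutelyContinuousOnInterval (fun s => G (f s)) a b := by
  rw [absolutelyContinuousOnInterval_iff] at hf ⊢
  intro ε hε
  -- `L + 1` rather than `L` keeps the denominator positive when `L = 0`.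
  obtain ⟨δ, hδ, h⟩ := hf (ε / (L + 1)) (by positivity)
  refine ⟨δ, hδ, fun E hE hE' => ?_⟩
  have h1 := h E hE hE'
  rw [lt_div_iff₀ (by positivity)] at h1
  refine lt_of_le_of_lt ?_ h1
  rw [Finset.sum_mul]
  refine Finset.sum_le_sum fun i _ => (hG.dist_le_mul _ _).trans ?_
  nlinarith [dist_nonneg (x := f (E.2 i).1) (y := f (E.2 i).2)]

lemma lipschitzWith_truncPrim {K : ℝ} (hK : 0 ≤ K) : LipschitzWith ⟨K, hK⟩ (truncPrim K) := by
  refine lipschitzWith_of_nnnorm_deriv_le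
    (fun r => (hasDerivAt_truncPrim hK r).differentiableAt) fun r => ?_
  rw [(hasDerivAt_truncPrim hK r).deriv]
  exact abs_trunc_le hK r

/-- `truncPrim K` is Lipschitz, so its composition with a primitive is absolutely continuous. It is
also differentiable everywhere, so the chain rule holds wherever the primitive is differentiable
with derivative `p`. -/
lemma integral_trunc_primitive {K : ℝ} (hK : 0 ≤ K) (hp : IntervalIntegrable p volume 0 t)
    (a : ℝ) :
    ∫ s in (0 : ℝ)..t, trunc K (a + ∫ r in (0 : ℝ)..s, p r) * p s
      = truncPrim K (a + ∫ r in (0 : ℝ)..t, p r) - truncPrim K a := by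
  have h := ((lipschitzWith_truncPrim hK).comp_absolutelyContinuousOnInterval
    (absolutelyContinuous_primitive hp a)).integral_deriv_eq_sub
  simp only [intervalIntegral.integral_same, add_zero] at h
  rw [← h]
  refine intervalIntegral.integral_congr_ae ?_
  filter_upwards [ae_hasDerivAt_primitive hp a] with s h1 hs
  exact ((hasDerivAt_truncPrim hK _).comp s (h1 (uIoc_subset_uIcc hs))).deriv.symm

end Path

/-! ### Integration over space-time -/

section SpaceTime

variable {μ : Measure E3} [IsFiniteMeasure μ] {T t : ℝ}

lemma timeProd_mono (ht : t ≤ T) : timeProd t μ ≤ timeProd T μ := by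
  unfold timeProd
  rw [Measure.le_iff]
  intro s hs
  rw [Measure.prod_apply hs, Measure.prod_apply hs]
  exact lintegral_mono' (Measure.restrict_mono (Ioo_subset_Ioo_right ht) le_rfl) le_rfl

lemma intervalIntegral_eq_Ioo (ht : 0 ≤ t) (p : ℝ → ℝ) :
    ∫ s in (0 : ℝ)..t, p s = ∫ s in Ioo (0 : ℝ) t, p s := by
  rw [intervalIntegral.integral_of_le ht, integral_Ioc_eq_integral_Ioo]

lemma intervalIntegrable_iff_Ioo (ht : 0 ≤ t) (p : ℝ → ℝ) :
    IntervalIntegrable p volume 0 t ↔ Integrable p (volume.restrict (Ioo (0 : ℝ) t)) :=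
  intervalIntegrable_iff_integrableOn_Ioo_of_le ht

lemma ae_ae_swap {P : ℝ × E3 → Prop} (h : ∀ᵐ z ∂(timeProd T μ), P z) :
    ∀ᵐ x ∂μ, ∀ᵐ s ∂(volume.restrict (Ioo (0 : ℝ) T)), P (s, x) := by
  have h' : ∀ᵐ z ∂(μ.prod (volume.restrict (Ioo (0 : ℝ) T))), P z.swap :=
    Measure.measurePreserving_swap.quasiMeasurePreserving.ae h
  exact Measure.ae_ae_of_ae_prod h'

lemma intervalIntegral_integral_eq (ht : 0 ≤ t) {H : ℝ → E3 → ℝ}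
    (h : Integrable (Function.uncurry H) (timeProd t μ)) :
    ∫ s in (0 : ℝ)..t, ∫ x, H s x ∂μ = ∫ x, (∫ s in (0 : ℝ)..t, H s x) ∂μ := by
  simp_rw [intervalIntegral_eq_Ioo ht]
  exact integral_integral_swap h

lemma intervalIntegrable_integral (ht : 0 ≤ t) {H : ℝ → E3 → ℝ}
    (h : Integrable (Function.uncurry H) (timeProd t μ)) :
    IntervalIntegrable (fun s => ∫ x, H s x ∂μ) volume 0 t :=
  (intervalIntegrable_iff_Ioo ht _).mpr h.integral_prod_left

lemma integrable_intervalIntegral (ht : 0 ≤ t) {H : ℝ → E3 → ℝ}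
    (h : Integrable (Function.uncurry H) (timeProd t μ)) :
    Integrable (fun x => ∫ s in (0 : ℝ)..t, H s x) μ := by
  simp_rw [intervalIntegral_eq_Ioo ht]
  exact h.integral_prod_right

lemma ae_intervalIntegrable (ht : 0 ≤ t) {H : ℝ → E3 → ℝ}
    (h : Integrable (Function.uncurry H) (timeProd t μ)) :
    ∀ᵐ x ∂μ, IntervalIntegrable (fun s => H s x) volume 0 t := by
  filter_upwards [h.prod_left_ae] with x hx
  exact (intervalIntegrable_iff_Ioo ht _).mpr hx

/-- Passing from iterated to joint null sets needs a measurable set, hence the strong measurability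
assumptions and the use of measurable representatives in `IsTimeH1.ae_path`. -/
lemma ae_timeProd_of_ae_ae {f g : ℝ × E3 → ℝ} (hf : StronglyMeasurable f)
    (hg : StronglyMeasurable g)
    (h : ∀ᵐ s ∂(volume.restrict (Ioo (0 : ℝ) T)), ∀ᵐ x ∂μ, f (s, x) = g (s, x)) :
    ∀ᵐ z ∂(timeProd T μ), f z = g z :=
  (Measure.ae_prod_mem_iff_ae_ae_mem (hf.measurableSet_eq_fun hg)).mpr h

/-! ### Calculus for functions in $H^1(0,T;L^2)$ -/

namespace IsTimeH1

variable {w w' a a' b b' : ℝ → E3 → ℝ}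

lemma integrable (h : IsTimeH1 T μ w w') : Integrable (Function.uncurry w) (timeProd T μ) :=
  h.memLp.integrable (by norm_num)

lemma deriv_integrable (h : IsTimeH1 T μ w w') :
    Integrable (Function.uncurry w') (timeProd T μ) :=
  h.deriv_memLp.integrable (by norm_num)

/-- Almost all paths are absolutely continuous. -/
lemma ae_path (h : IsTimeH1 T μ w w') :
    ∀ᵐ x ∂μ, ∀ᵐ s ∂(volume.restrict (Ioo (0 : ℝ) T)),
      w s x = w 0 x + ∫ r in (0 : ℝ)..s, w' r x := by
  have hv := h.deriv_memLp.aestronglyMeasurable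
  have hu := h.memLp.aestronglyMeasurable
  have h0 := h.init_memLp.aestronglyMeasurable
  -- In `eq_integral` the exceptional null set depends on the time. To exchange quantifiers by
  -- Fubini, the right side is given a jointly measurable version; the indicator turns the variable
  -- upper limit into a fixed domain of integration.
  let A : ℝ × E3 → ℝ := fun z =>
    h0.mk _ z.2 + ∫ r in Ioo 0 T, (Iic z.1).indicator (fun r => hv.mk _ (r, z.2)) r
  have hA : StronglyMeasurable A := by
    refine (h0.stronglyMeasurable_mk.comp_measurable measurable_snd).add ?_
    refine StronglyMeasurable.integral_prod_right' (ν := volume.restrict (Ioo (0 : ℝ) T))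
      (f := fun y : (ℝ × E3) × ℝ => (Iic y.1.1).indicator (fun r => hv.mk _ (r, y.1.2)) y.2) ?_
    have hset : MeasurableSet {y : (ℝ × E3) × ℝ | y.2 ≤ y.1.1} :=
      measurableSet_le (by fun_prop) (by fun_prop)
    have hm : StronglyMeasurable fun y : (ℝ × E3) × ℝ => hv.mk _ (y.2, y.1.2) :=
      hv.stronglyMeasurable_mk.comp_measurable (by fun_prop)
    exact hm.indicator hset
  have hAeq : ∀ᵐ x ∂μ, ∀ s ∈ Ioo 0 T, A (s, x) = w 0 x + ∫ r in (0 : ℝ)..s, w' r x := by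
    filter_upwards [ae_ae_swap hv.ae_eq_mk, h0.ae_eq_mk] with x hx hx0 s hs
    simp only [A]
    rw [← hx0, intervalIntegral.integral_of_le hs.1.le,
      integral_indicator measurableSet_Iic, Measure.restrict_restrict measurableSet_Iic]
    have hset : Iic s ∩ Ioo 0 T = Ioc 0 s := by
      ext r
      simp only [mem_inter_iff, mem_Iic, mem_Ioo, mem_Ioc]
      exact ⟨fun hr => ⟨hr.2.1, hr.1⟩, fun hr => ⟨hr.2, hr.1, hr.2.trans_lt hs.2⟩⟩
    rw [hset]
    congr 1
    refine integral_congr_ae ?_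
    have hsub : Ioc 0 s ⊆ Ioo 0 T := fun r hr => ⟨hr.1, hr.2.trans_lt hs.2⟩
    exact (ae_restrict_of_ae_restrict_of_subset hsub hx).mono fun r hr => hr.symm
  have hmem : ∀ᵐ s ∂(volume.restrict (Ioo (0 : ℝ) T)), s ∈ Ioo (0 : ℝ) T :=
    ae_restrict_mem measurableSet_Ioo
  have hprod : ∀ᵐ z ∂(timeProd T μ), hu.mk _ z = A z := by
    refine ae_timeProd_of_ae_ae hu.stronglyMeasurable_mk hA ?_
    filter_upwards [Measure.ae_ae_of_ae_prod hu.ae_eq_mk, hmem] with s hs hsT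
    filter_upwards [hs, hAeq, h.eq_integral s ⟨hsT.1.le, hsT.2.le⟩] with x h1 h2 h3
    rw [← h1, h2 s hsT, ← h3]
    rfl
  filter_upwards [ae_ae_swap hprod, ae_ae_swap hu.ae_eq_mk, hAeq] with x h1 h2 h3
  filter_upwards [h1, h2, hmem] with s h4 h5 h6
  rw [← h3 s h6, ← h4, ← h5]
  rfl

lemma integrable_slice (h : IsTimeH1 T μ w w') (ht : t ∈ Icc 0 T) : Integrable (w t) μ := by
  have h1 := integrable_intervalIntegral ht.1 (h.deriv_integrable.mono_measure (timeProd_mono ht.2))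
  exact ((h.init_memLp.integrable (by norm_num)).add h1).congr
    ((h.eq_integral t ht).mono fun x hx => hx.symm)

lemma ae_path_restrict (h : IsTimeH1 T μ w w') (ht : t ∈ Icc 0 T) :
    ∀ᵐ x ∂μ, ∀ᵐ s, s ∈ uIoc 0 t → w s x = w 0 x + ∫ r in (0 : ℝ)..s, w' r x := by
  filter_upwards [h.ae_path] with x hx
  rw [ae_restrict_iff' measurableSet_Ioo] at hx
  have hT : ∀ᵐ s : ℝ, s ≠ T := by simp [ae_iff, measure_singleton]
  filter_upwards [hx, hT] with s hs hsT hst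
  rw [uIoc_of_le ht.1] at hst
  exact hs ⟨hst.1, lt_of_le_of_ne (hst.2.trans ht.2) hsT⟩

lemma integrable_mul_deriv (ha : IsTimeH1 T μ a a') (hb : IsTimeH1 T μ b b') :
    Integrable (Function.uncurry fun s x => a' s x * b s x + a s x * b' s x) (timeProd T μ) :=
  (integrable_mul_of_memLp ha.deriv_memLp hb.memLp).add
    (integrable_mul_of_memLp ha.memLp hb.deriv_memLp)

lemma ae_mul_eq (ha : IsTimeH1 T μ a a') (hb : IsTimeH1 T μ b b') (ht : t ∈ Icc 0 T) :
    ∀ᵐ x ∂μ, a t x * b t x - a 0 x * b 0 x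
      = ∫ s in (0 : ℝ)..t, (a' s x * b s x + a s x * b' s x) := by
  filter_upwards [ha.ae_path_restrict ht, hb.ae_path_restrict ht, ha.eq_integral t ht,
    hb.eq_integral t ht,
    ae_intervalIntegrable ht.1 (ha.deriv_integrable.mono_measure (timeProd_mono ht.2)),
    ae_intervalIntegrable ht.1 (hb.deriv_integrable.mono_measure (timeProd_mono ht.2))]
    with x h1 h2 h3 h4 h5 h6
  rw [h3, h4, ← integral_primitive_mul h5 h6]
  refine intervalIntegral.integral_congr_ae ?_
  filter_upwards [h1, h2] with s h7 h8 hs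
  rw [h7 hs, h8 hs]

/-- A function in `H¹(0, T; L²)` is square integrable at every time. -/
lemma memLp_slice (h : IsTimeH1 T μ w w') (ht : t ∈ Icc 0 T) : MemLp (w t) 2 μ := by
  refine (memLp_two_iff_integrable_sq (h.integrable_slice ht).aestronglyMeasurable).mpr ?_
  -- The product rule writes $w(t)^2$ as $w(0)^2+\int_0^t2ww'$, a sum of integrable functions.
  have h1 := integrable_intervalIntegral ht.1
    ((h.integrable_mul_deriv h).mono_measure (timeProd_mono ht.2))
  refine ((integrable_mul_of_memLp h.init_memLp h.init_memLp).add h1).congr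
    ((h.ae_mul_eq h ht).mono fun x hx => ?_)
  simp only [Pi.add_apply]
  rw [← hx]
  ring

lemma integrable_trunc_mul_deriv {K : ℝ} (hK : 0 ≤ K) (h : IsTimeH1 T μ w w') :
    Integrable (Function.uncurry fun s x => trunc K (w s x) * w' s x) (timeProd T μ) :=
  h.deriv_integrable.bdd_mul (c := K)
    ((continuous_trunc K).comp_aestronglyMeasurable h.memLp.aestronglyMeasurable)
    (Eventually.of_forall fun _ => abs_trunc_le hK _)

lemma integrable_truncPrim {K : ℝ} (hK : 0 ≤ K) {v : E3 → ℝ} (hv : Integrable v μ) :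
    Integrable (fun x => truncPrim K (v x)) μ := by
  refine Integrable.mono' (hv.abs.const_mul K)
    ((lipschitzWith_truncPrim hK).continuous.comp_aestronglyMeasurable hv.aestronglyMeasurable)
    (Eventually.of_forall fun x => ?_)
  rw [Real.norm_eq_abs, abs_of_nonneg (truncPrim_nonneg hK _)]
  exact truncPrim_le hK _

/-- The fundamental theorem of calculus for the primitive of the truncation. -/
lemma integral_truncPrim_sub {K : ℝ} (hK : 0 ≤ K) (h : IsTimeH1 T μ w w') (ht : t ∈ Icc 0 T) :
    (∫ x, truncPrim K (w t x) ∂μ) - ∫ x, truncPrim K (w 0 x) ∂μ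
      = ∫ s in (0 : ℝ)..t, ∫ x, trunc K (w s x) * w' s x ∂μ := by
  rw [intervalIntegral_integral_eq ht.1
    ((h.integrable_trunc_mul_deriv hK).mono_measure (timeProd_mono ht.2)),
    ← integral_sub (integrable_truncPrim hK (h.integrable_slice ht))
      (integrable_truncPrim hK (h.init_memLp.integrable (by norm_num)))]
  refine integral_congr_ae ?_
  filter_upwards [h.ae_path_restrict ht, h.eq_integral t ht,
    ae_intervalIntegrable ht.1 (h.deriv_integrable.mono_measure (timeProd_mono ht.2))]
    with x h1 h2 h3
  rw [h2, ← integral_trunc_primitive hK h3]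
  refine intervalIntegral.integral_congr_ae ?_
  filter_upwards [h1] with s h4 hs
  rw [h4 hs]

lemma sub (ha : IsTimeH1 T μ a a') (hb : IsTimeH1 T μ b b') :
    IsTimeH1 T μ (fun t x => a t x - b t x) (fun t x => a' t x - b' t x) where
  memLp := ha.memLp.sub hb.memLp
  deriv_memLp := ha.deriv_memLp.sub hb.deriv_memLp
  init_memLp := ha.init_memLp.sub hb.init_memLp
  eq_integral t ht := by
    filter_upwards [ha.eq_integral t ht, hb.eq_integral t ht,
      ae_intervalIntegrable ht.1 (ha.deriv_integrable.mono_measure (timeProd_mono ht.2)),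
      ae_intervalIntegrable ht.1 (hb.deriv_integrable.mono_measure (timeProd_mono ht.2))]
      with x h1 h2 h3 h4
    rw [h1, h2, intervalIntegral.integral_sub h3 h4]
    ring

lemma const_mul (c : ℝ) (ha : IsTimeH1 T μ a a') :
    IsTimeH1 T μ (fun t x => c * a t x) (fun t x => c * a' t x) where
  memLp := ha.memLp.const_mul c
  deriv_memLp := ha.deriv_memLp.const_mul c
  init_memLp := ha.init_memLp.const_mul c
  eq_integral t ht := by
    filter_upwards [ha.eq_integral t ht] with x h1
    rw [h1, intervalIntegral.integral_const_mul]
    ring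

lemma sum {ι : Type*} (S : Finset ι) {a a' : ι → ℝ → E3 → ℝ}
    (ha : ∀ i ∈ S, IsTimeH1 T μ (a i) (a' i)) :
    IsTimeH1 T μ (fun t x => ∑ i ∈ S, a i t x) (fun t x => ∑ i ∈ S, a' i t x) where
  memLp := memLp_finsetSum S fun i hi => (ha i hi).memLp
  deriv_memLp := memLp_finsetSum S fun i hi => (ha i hi).deriv_memLp
  init_memLp := memLp_finsetSum S fun i hi => (ha i hi).init_memLp
  eq_integral t ht := by
    have h1 : ∀ᵐ x ∂μ, ∀ i ∈ S, a i t x = a i 0 x + ∫ s in (0 : ℝ)..t, a' i s x :=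
      (ae_ball_iff S.countable_toSet).mpr fun i hi => (ha i hi).eq_integral t ht
    have h2 : ∀ᵐ x ∂μ, ∀ i ∈ S, IntervalIntegrable (fun s => a' i s x) volume 0 t :=
      (ae_ball_iff S.countable_toSet).mpr fun i hi =>
        ae_intervalIntegrable ht.1 ((ha i hi).deriv_integrable.mono_measure (timeProd_mono ht.2))
    filter_upwards [h1, h2] with x h3 h4
    rw [intervalIntegral.integral_finsetSum h4, ← Finset.sum_add_distrib]
    exact Finset.sum_congr rfl h3

/-- A bound uniform in time but dependent on the solution. It supplies the finiteness that the
Gronwall argument assumes. -/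
lemma integral_abs_le (h : IsTimeH1 T μ w w') (ht : t ∈ Icc 0 T) :
    ∫ x, |w t x| ∂μ ≤ (∫ x, |w 0 x| ∂μ) + ∫ x, (∫ s in (0 : ℝ)..T, |w' s x|) ∂μ := by
  have hT : 0 ≤ T := ht.1.trans ht.2
  have habs : Integrable (Function.uncurry fun s x => |w' s x|) (timeProd T μ) :=
    h.deriv_integrable.abs
  have h0 := (h.init_memLp.integrable (q := 2) (by norm_num)).abs
  have h1 := integrable_intervalIntegral hT habs
  rw [← integral_add h0 h1]
  refine integral_mono_ae (h.integrable_slice ht).abs (h0.add h1) ?_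
  filter_upwards [h.eq_integral t ht, ae_intervalIntegrable hT habs] with x h2 h3
  rw [h2]
  refine (abs_add_le _ _).trans (add_le_add le_rfl ?_)
  refine (intervalIntegral.abs_integral_le_integral_abs ht.1).trans ?_
  exact intervalIntegral.integral_mono_interval le_rfl ht.1 ht.2
    (Eventually.of_forall fun s => abs_nonneg _) h3

end IsTimeH1

end SpaceTime

/-! ### Gronwall's inequality -/

/-- Gronwall's inequality for bounded functions, without continuity. -/
lemma le_exp_of_le_integral {y : ℝ → ℝ} {T B c₀ c₁ : ℝ} (hc₀ : 0 ≤ c₀) (hc₁ : 0 < c₁)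
    (hB : ∀ t ∈ Icc 0 T, y t ≤ B) (hy0 : ∀ t, 0 ≤ y t)
    (hint : IntervalIntegrable y volume 0 T)
    (h : ∀ t ∈ Icc 0 T, y t ≤ c₀ + c₁ * ∫ s in (0 : ℝ)..t, y s) :
    ∀ t ∈ Icc 0 T, y t ≤ 2 * c₀ * Real.exp (2 * c₁ * t) := by
  intro t₀ ht₀
  -- Let $m$ be the supremum of $y(t)e^{-2c_1t}$, finite by `hB`. Integrating $e^{2c_1s}$ gains a
  -- factor $1/(2c_1)$, so $m\le c_0+m/2$. The value of `B` does not enter the result.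
  set z : ℝ → ℝ := fun t => y t * Real.exp (-(2 * c₁ * t)) with hz
  have hbdd : BddAbove (z '' Icc 0 T) := by
    refine ⟨B, ?_⟩
    rintro _ ⟨t, ht, rfl⟩
    have : Real.exp (-(2 * c₁ * t)) ≤ 1 := Real.exp_le_one_iff.mpr (by
      have := mul_nonneg hc₁.le ht.1; linarith)
    exact (mul_le_of_le_one_right (hy0 t) this).trans (hB t ht)
  set m := sSup (z '' Icc 0 T) with hm
  have hle : ∀ t ∈ Icc 0 T, y t ≤ m * Real.exp (2 * c₁ * t) := fun t ht => by
    have h1 : z t ≤ m := le_csSup hbdd ⟨t, ht, rfl⟩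
    have h2 : y t = z t * Real.exp (2 * c₁ * t) := by
      simp only [hz]
      rw [mul_assoc, ← Real.exp_add]
      simp
    rw [h2]
    exact mul_le_mul_of_nonneg_right h1 (Real.exp_pos _).le
  have hm0 : 0 ≤ m :=
    le_trans (mul_nonneg (hy0 t₀) (Real.exp_pos _).le) (le_csSup hbdd ⟨t₀, ht₀, rfl⟩)
  have hexp : ∀ t : ℝ, ∫ s in (0 : ℝ)..t, m * Real.exp (2 * c₁ * s)
      = m * ((Real.exp (2 * c₁ * t) - 1) / (2 * c₁)) := fun t => by
    rw [intervalIntegral.integral_const_mul,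
      intervalIntegral.integral_comp_mul_left (fun s => Real.exp s) (by positivity)]
    simp [integral_exp]
    left
    field_simp
  have hstep : m ≤ c₀ + m / 2 := by
    refine csSup_le ⟨_, t₀, ht₀, rfl⟩ ?_
    rintro _ ⟨t, ht, rfl⟩
    have h1 : ∫ s in (0 : ℝ)..t, y s ≤ ∫ s in (0 : ℝ)..t, m * Real.exp (2 * c₁ * s) := by
      refine intervalIntegral.integral_mono_on ht.1
        (hint.mono_set (uIcc_subset_uIcc_left (by rw [uIcc_of_le (ht.1.trans ht.2)]; exact ht)))
        (Continuous.intervalIntegrable (by fun_prop) _ _)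
        fun s hs => hle s ⟨hs.1, hs.2.trans ht.2⟩
    have h2 := h t ht
    rw [hexp] at h1
    have h3 : y t ≤ c₀ + m / 2 * (Real.exp (2 * c₁ * t) - 1) := by
      have h4 := mul_le_mul_of_nonneg_left h1 hc₁.le
      have h5 : c₁ * (m * ((Real.exp (2 * c₁ * t) - 1) / (2 * c₁)))
          = m / 2 * (Real.exp (2 * c₁ * t) - 1) := by
        field_simp
      linarith
    have h6 : 1 ≤ Real.exp (2 * c₁ * t) :=
      Real.one_le_exp (by have := mul_nonneg hc₁.le ht.1; linarith)
    have h7 : y t ≤ (c₀ + m / 2) * Real.exp (2 * c₁ * t) := by nlinarith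
    simp only [hz]
    rw [Real.exp_neg, ← div_eq_mul_inv, div_le_iff₀ (Real.exp_pos _)]
    exact h7
  have hm2 : m ≤ 2 * c₀ := by linarith
  exact (hle t₀ ht₀).trans (mul_le_mul_of_nonneg_right hm2 (Real.exp_pos _).le)

/-! ### The energy inequality at a fixed time -/

section L2Matrix

variable {α : Type*} [MeasurableSpace α] {μ : Measure α}

lemma memLp_symPart {G : α → Mat3} (hG : ∀ i j, MemLp (fun x => G x i j) 2 μ) (i j : Fin 3) :
    MemLp (fun x => symPart (G x) i j) 2 μ :=
  ((hG i j).add (hG j i)).const_mul (1 / 2)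

lemma memLp_linearMap (D : Mat3 →ₗ[ℝ] Mat3) {A : α → Mat3}
    (hA : ∀ i j, MemLp (fun x => A x i j) 2 μ) (i j : Fin 3) :
    MemLp (fun x => D (A x) i j) 2 μ := by
  simp_rw [linearMap_apply_entry D (A _) i j]
  exact memLp_finsetSum _ fun k _ => memLp_finsetSum _ fun l _ => (hA k l).const_mul _

lemma integrable_linearCombination {a b c d : α → ℝ} (ha : Integrable a μ) (hb : Integrable b μ)
    (hc : Integrable c μ) (hd : Integrable d μ) (r s t : ℝ) :
    Integrable (fun x => a x + r * b x + s * c x + t * d x) μ :=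
  ((ha.add (hb.const_mul r)).add (hc.const_mul s)).add (hd.const_mul t)

lemma integral_linearCombination {a b c d : α → ℝ} (ha : Integrable a μ) (hb : Integrable b μ)
    (hc : Integrable c μ) (hd : Integrable d μ) (r s t : ℝ) :
    ∫ x, (a x + r * b x + s * c x + t * d x) ∂μ
      = (∫ x, a x ∂μ) + r * (∫ x, b x ∂μ) + s * (∫ x, c x ∂μ) + t * ∫ x, d x ∂μ := by
  have h1 : Integrable (fun x => a x + r * b x) μ := ha.add (hb.const_mul r)
  have h2 : Integrable (fun x => a x + r * b x + s * c x) μ := h1.add (hc.const_mul s)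
  rw [integral_add h2 (hd.const_mul t), integral_add h1 (hc.const_mul s),
    integral_add ha (hb.const_mul r), integral_const_mul, integral_const_mul, integral_const_mul]

lemma exists_abs_comp_trunc_le {f : ℝ → ℝ} (hf : Continuous f) {L : ℝ} (hL : 0 ≤ L) :
    ∃ M, ∀ r, |f (trunc L r)| ≤ M := by
  obtain ⟨M, hM⟩ := (isCompact_Icc (a := -L) (b := L)).exists_bound_of_continuousOn hf.continuousOn
  exact ⟨M, fun r => hM _ (abs_le.mp (abs_trunc_le hL r))⟩

lemma memLp_comp_trunc [IsFiniteMeasure μ] {f : ℝ → ℝ} (hf : Continuous f) {L : ℝ} (hL : 0 ≤ L)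
    {v : α → ℝ} (hv : AEStronglyMeasurable v μ) : MemLp (fun x => f (trunc L (v x))) 2 μ := by
  obtain ⟨M, hM⟩ := exists_abs_comp_trunc_le hf hL
  exact MemLp.of_bound ((hf.comp (continuous_trunc L)).comp_aestronglyMeasurable hv) M
    (Eventually.of_forall fun x => hM _)

end L2Matrix

/-- The product of the thermal stress and of the divergence of the velocity, weighted by
`1 - trunc K θ / K`, is absorbed by the viscous dissipation. -/
lemma mul_trace_le {c C X b : ℝ} (hc : 0 < c) {S : Mat3} (hX : X ^ 2 ≤ C * b) :
    X * S.trace ≤ c / 4 * ddot S S + 3 * C / c * b := by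
  have h1 := trace_sq_le S
  -- Young's inequality with weight $c/12$, since $(\operatorname{tr}S)^2\le3|S|^2$ then yields
  -- exactly $c/4$.
  have h2 : X * S.trace ≤ c / 12 * S.trace ^ 2 + 3 / c * X ^ 2 := by
    have h3 := sq_nonneg (c / 6 * S.trace - X)
    have h4 : c / 12 * S.trace ^ 2 + 3 / c * X ^ 2 - X * S.trace
        = 3 / c * (c / 6 * S.trace - X) ^ 2 := by
      field_simp
      ring
    have h5 : 0 ≤ 3 / c * (c / 6 * S.trace - X) ^ 2 := by positivity
    linarith
  have h6 : 3 / c * X ^ 2 ≤ 3 / c * (C * b) := mul_le_mul_of_nonneg_left hX (by positivity)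
  have h7 : 3 / c * (C * b) = 3 * C / c * b := by ring
  have h8 : c / 12 * S.trace ^ 2 ≤ c / 12 * (3 * ddot S S) :=
    mul_le_mul_of_nonneg_left h1 (by positivity)
  linarith

/-- Here `e`, `p`, `G` stand for the elastic strain, $\varepsilon^p_t$ and $\nabla u_t$, and `u` is
the velocity. Of the viscous coercivity `c`, a quarter absorbs the thermal coupling, a quarter the
force, and half survives on the left. -/
lemma energy_inequality_slice {Ω : Set E3} (hΩ : IsOpen Ω) (hb : Bornology.IsBounded Ω) {R : ℝ}
    (hR0 : 0 < R) (hR : ∀ x ∈ Ω, ‖x‖ ≤ R) {D : Mat3 →ₗ[ℝ] Mat3} (hD : IsElasticityTensor D)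
    {c : ℝ} (hc : 0 < c) (hcD : ∀ A : Mat3, A.IsSymm → c * ddot A A ≤ ddot (D A) A)
    {f : ℝ → ℝ} (hf : Continuous f) {K C : ℝ} (hK : 0 < K)
    (hgrowth : ∀ L, 0 < L → ∀ a b,
      (f (trunc L (a + b)) * (1 - trunc K a / K)) ^ 2 ≤ C * (1 + |a| + b ^ 2))
    {k lam : ℝ} (hlam : 0 < lam)
    {e p G : E3 → Mat3} {u F q : E3 → Fin 3 → ℝ} {θ θ' θl : E3 → ℝ}
    (he : ∀ i j, MemLp (fun x => e x i j) 2 (bulk Ω)) (hes : ∀ᵐ x ∂(bulk Ω), (e x).IsSymm)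
    (hp : ∀ i j, MemLp (fun x => p x i j) 2 (bulk Ω))
    (hflow : ∀ᵐ x ∂(bulk Ω), p x = yosida k lam (D (e x)))
    (hu : ∀ i, MemH10 Ω (fun x => u x i) fun x j => G x i j)
    (hF : ∀ i, MemLp (fun x => F x i) 2 (bulk Ω))
    (hθ : MemH1 Ω θ q) (hθ' : MemLp θ' 2 (bulk Ω)) (hθl : MemLp θl 2 (bulk Ω))
    (hmom : ∀ φ : Fin 3 → E3 → ℝ, (∀ i, IsTest Ω (φ i)) →
      ∫ x in Ω, ddot (D (e x) - f (trunc (1 / lam) (θ x + θl x)) • (1 : Mat3) + D (symPart (G x)))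
        (Matrix.of fun i j => pderiv j (φ i) x) = ∫ x in Ω, ∑ i, F x i * φ i x)
    (hheat : ∀ (v : E3 → ℝ) (Gv : E3 → Fin 3 → ℝ), MemH1 Ω v Gv →
      (∫ x in Ω, θ' x * v x) + ∫ x in Ω, ∑ i, q x i * Gv x i
        = ∫ x in Ω, (- f (trunc (1 / lam) (θ x + θl x)) * (G x).trace
            + trunc (1 / lam) (ddot (p x) (D (e x)))) * v x) :
    (∫ x in Ω, ddot (D (e x)) (symPart (G x) - p x)) + 1 / K * (∫ x in Ω, trunc K (θ x) * θ' x)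
        + c / 2 * (∫ x in Ω, ddot (symPart (G x)) (symPart (G x)))
        + 1 / K * (∫ x in Ω, ∑ i, (truncDeriv K (θ x) * q x i) ^ 2)
      ≤ (3 * C / c + 4 * R ^ 2 / c)
          * ∫ x in Ω, (1 + |θ x| + θl x ^ 2 + ∑ i, F x i ^ 2) := by
  have hfin := isFiniteMeasure_bulk hb
  set L := 1 / lam with hL
  have hL0 : 0 < L := by positivity
  set τ : E3 → ℝ := fun x => f (trunc L (θ x + θl x)) with hτ
  set w : E3 → ℝ := fun x => trunc K (θ x) with hw
  have hwH := hθ.trunc hΩ hb hK.le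
  have hwm : AEStronglyMeasurable w (bulk Ω) := hwH.memLp.aestronglyMeasurable
  have hwb : ∀ x, ‖w x‖ ≤ K := fun x => abs_trunc_le hK.le _
  have hτ2 : MemLp τ 2 (bulk Ω) := memLp_comp_trunc hf hL0.le
    (hθ.memLp.aestronglyMeasurable.add hθl.aestronglyMeasurable)
  have hG : ∀ i j, MemLp (fun x => G x i j) 2 (bulk Ω) := fun i j => (hu i).memH1.grad_memLp j
  have hu2 : ∀ i, MemLp (fun x => u x i) 2 (bulk Ω) := fun i => (hu i).memH1.memLp
  have hS := memLp_symPart hG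
  have hDe := memLp_linearMap D he
  have hDS := memLp_linearMap D hS
  have htr : MemLp (fun x => (G x).trace) 2 (bulk Ω) := by
    unfold Matrix.trace
    exact memLp_finsetSum _ fun i _ => hG i i
  have hσ : ∀ i j, MemLp (fun x => (D (e x) - τ x • (1 : Mat3) + D (symPart (G x))) i j) 2
      (bulk Ω) := fun i j =>
    ((hDe i j).sub (hτ2.mul_const ((1 : Mat3) i j))).add (hDS i j)
  -- the integrands
  have i1 : Integrable (fun x => ddot (D (e x)) (symPart (G x) - p x)) (bulk Ω) :=
    integrable_ddot hDe fun i j => (hS i j).sub (hp i j)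
  have iσ : Integrable (fun x => ddot (D (e x) - τ x • (1 : Mat3) + D (symPart (G x))) (G x))
    (bulk Ω) := integrable_ddot hσ hG
  have iS : Integrable (fun x => ddot (symPart (G x)) (symPart (G x))) (bulk Ω) :=
    integrable_ddot hS hS
  have iz : Integrable (fun x => ddot (p x) (D (e x))) (bulk Ω) := integrable_ddot hp hDe
  have iθ' : Integrable (fun x => θ' x * w x) (bulk Ω) := integrable_mul_of_memLp hθ' hwH.memLp
  have iq : Integrable (fun x => ∑ i, q x i * (truncDeriv K (θ x) * q x i)) (bulk Ω) :=
    integrable_finsetSum _ fun i _ =>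
      integrable_mul_of_memLp (hθ.grad_memLp i) (hwH.grad_memLp i)
  have iH : Integrable (fun x => ∑ i, (truncDeriv K (θ x) * q x i) ^ 2) (bulk Ω) :=
    integrable_finsetSum _ fun i _ => (hwH.grad_memLp i).integrable_sq
  have itd : Integrable (fun x => τ x * (G x).trace) (bulk Ω) := integrable_mul_of_memLp hτ2 htr
  have itz : Integrable (fun x => trunc L (ddot (p x) (D (e x)))) (bulk Ω) :=
    Integrable.of_bound ((continuous_trunc L).comp_aestronglyMeasurable iz.aestronglyMeasurable) L
      (Eventually.of_forall fun x => abs_trunc_le hL0.le _)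
  have irhs : Integrable (fun x => (- τ x * (G x).trace + trunc L (ddot (p x) (D (e x)))) * w x)
      (bulk Ω) := by
    have : Integrable (fun x => - τ x * (G x).trace + trunc L (ddot (p x) (D (e x)))) (bulk Ω) := by
      simp_rw [neg_mul]
      exact itd.neg.add itz
    exact this.mul_bdd (c := K) hwm (Eventually.of_forall hwb)
  have iF : ∀ i, Integrable (fun x => F x i ^ 2) (bulk Ω) := fun i => (hF i).integrable_sq
  have iu : ∀ i, Integrable (fun x => u x i ^ 2) (bulk Ω) := fun i => (hu2 i).integrable_sq
  have iFu : Integrable (fun x => ∑ i, F x i * u x i) (bulk Ω) :=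
    integrable_finsetSum _ fun i _ => integrable_mul_of_memLp (hF i) (hu2 i)
  have ibase : Integrable (fun x => 1 + |θ x| + θl x ^ 2) (bulk Ω) :=
    ((integrable_const _).add (hθ.memLp.integrable (by norm_num)).abs).add hθl.integrable_sq
  have isF : Integrable (fun x => ∑ i, F x i ^ 2) (bulk Ω) :=
    integrable_finsetSum _ fun i _ => iF i
  -- the two tested equations
  have hM := integral_ddot_eq_of_forall_test hσ hF hmom hu
  have hN := hheat w _ hwH
  -- the force
  have hforce : ∫ x in Ω, ∑ i, F x i * u x i ≤ 4 * R ^ 2 / c * (∫ x in Ω, ∑ i, F x i ^ 2)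
      + c / 4 * ∫ x in Ω, ddot (symPart (G x)) (symPart (G x)) := by
    have h1 : ∫ x in Ω, ∑ i, F x i * u x i
        ≤ ∫ x in Ω, (4 * R ^ 2 / c * (∑ i, F x i ^ 2) + c / (16 * R ^ 2) * ∑ i, u x i ^ 2) := by
      refine integral_mono iFu ((isF.const_mul _).add
        ((integrable_finsetSum _ fun i _ => iu i).const_mul _)) fun x => ?_
      simp only [Finset.mul_sum, ← Finset.sum_add_distrib]
      refine Finset.sum_le_sum fun i _ => ?_
      have h2 : 4 * R ^ 2 / c * F x i ^ 2 + c / (16 * R ^ 2) * u x i ^ 2 - F x i * u x i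
          = 4 * R ^ 2 / c * (F x i - c / (8 * R ^ 2) * u x i) ^ 2 := by
        field_simp
        ring
      have h3 : 0 ≤ 4 * R ^ 2 / c * (F x i - c / (8 * R ^ 2) * u x i) ^ 2 := by positivity
      linarith
    rw [integral_add (isF.const_mul _) ((integrable_finsetSum _ fun i _ => iu i).const_mul _),
      integral_const_mul, integral_const_mul] at h1
    -- Each component is estimated through its own diagonal derivative, so the strain alone
    -- suffices. The Young weight $c/(16R^2)$ was chosen so that the factor $4R^2$ leaves $c/4$.
    have h4 : ∫ x in Ω, ∑ i, u x i ^ 2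
        ≤ 4 * R ^ 2 * ∫ x in Ω, ddot (symPart (G x)) (symPart (G x)) := by
      have iGd : ∀ i, Integrable (fun x => G x i i ^ 2) (bulk Ω) := fun i => (hG i i).integrable_sq
      have h5 : ∫ x in Ω, ∑ i, G x i i ^ 2 ≤ ∫ x in Ω, ddot (symPart (G x)) (symPart (G x)) := by
        refine integral_mono (integrable_finsetSum _ fun i _ => iGd i) iS fun x => ?_
        have := sum_diag_sq_le (symPart (G x))
        simpa only [symPart_diag] using this
      rw [integral_finsetSum _ fun i _ => iGd i] at h5
      rw [integral_finsetSum _ fun i _ => iu i]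
      refine le_trans ?_ (mul_le_mul_of_nonneg_left h5 (by positivity))
      rw [Finset.mul_sum]
      exact Finset.sum_le_sum fun i _ => (hu i).poincare hR i
    have h6 : c / (16 * R ^ 2) * (∫ x in Ω, ∑ i, u x i ^ 2)
        ≤ c / (16 * R ^ 2) * (4 * R ^ 2 * ∫ x in Ω, ddot (symPart (G x)) (symPart (G x))) :=
      mul_le_mul_of_nonneg_left h4 (by positivity)
    have h7 : c / (16 * R ^ 2) * (4 * R ^ 2 * ∫ x in Ω, ddot (symPart (G x)) (symPart (G x)))
        = c / 4 * ∫ x in Ω, ddot (symPart (G x)) (symPart (G x)) := by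
      field_simp
      ring
    linarith
  -- the pointwise inequality
  have hpt : ∀ᵐ x ∂(bulk Ω),
      ddot (D (e x)) (symPart (G x) - p x) + 1 / K * (trunc K (θ x) * θ' x)
        + c / 2 * ddot (symPart (G x)) (symPart (G x))
        + 1 / K * (∑ i, (truncDeriv K (θ x) * q x i) ^ 2)
      ≤ ddot (D (e x) - τ x • (1 : Mat3) + D (symPart (G x))) (G x)
        + 1 / K * (θ' x * w x + (∑ i, q x i * (truncDeriv K (θ x) * q x i))
          - (- τ x * (G x).trace + trunc L (ddot (p x) (D (e x)))) * w x)
        + 3 * C / c * (1 + |θ x| + θl x ^ 2)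
        + -(c / 4) * ddot (symPart (G x)) (symPart (G x)) := by
    filter_upwards [hes, hflow] with x hex hfx
    have hSs := isSymm_symPart (G x)
    have hz : 0 ≤ ddot (p x) (D (e x)) := by rw [hfx]; exact ddot_yosida_nonneg hlam _
    have e1 : ddot (D (e x) - τ x • (1 : Mat3) + D (symPart (G x))) (G x)
        = ddot (D (e x)) (symPart (G x) - p x) + ddot (p x) (D (e x)) - τ x * (G x).trace
          + ddot (D (symPart (G x))) (symPart (G x)) := by
      rw [ddot_add_left, ddot_sub_left, ddot_smul_left, ddot_one_left, ddot_sub_right,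
        ddot_symPart (hD.map_symm _ hex), ddot_symPart (hD.map_symm _ hSs), ddot_comm (p x)]
      ring
    have e2 := mul_trace_le hc (S := symPart (G x)) (hgrowth L hL0 (θ x) (θl x))
    rw [trace_symPart] at e2
    have e3 := hcD _ hSs
    have e4 : trunc L (ddot (p x) (D (e x))) * (w x / K) ≤ ddot (p x) (D (e x)) :=
      trunc_mul_le hK hL0.le hz
    -- `truncDeriv` takes values in $[0,1]$, so its square is at most itself, also at the kinks.
    have e5 : ∑ i, (truncDeriv K (θ x) * q x i) ^ 2
        ≤ ∑ i, q x i * (truncDeriv K (θ x) * q x i) := by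
      refine Finset.sum_le_sum fun i _ => ?_
      have h1 := truncDeriv_nonneg hK.le (θ x)
      have h2 := truncDeriv_le_one K (θ x)
      have h3 : 0 ≤ truncDeriv K (θ x) * (1 - truncDeriv K (θ x)) * q x i ^ 2 :=
        mul_nonneg (mul_nonneg h1 (by linarith)) (sq_nonneg _)
      nlinarith
    have e6 : 1 / K * (∑ i, (truncDeriv K (θ x) * q x i) ^ 2)
        ≤ 1 / K * ∑ i, q x i * (truncDeriv K (θ x) * q x i) :=
      mul_le_mul_of_nonneg_left e5 (by positivity)
    have e7 : 1 / K * (θ' x * w x + (∑ i, q x i * (truncDeriv K (θ x) * q x i))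
          - (- τ x * (G x).trace + trunc L (ddot (p x) (D (e x)))) * w x)
        = 1 / K * (trunc K (θ x) * θ' x) + 1 / K * (∑ i, q x i * (truncDeriv K (θ x) * q x i))
          + τ x * (w x / K) * (G x).trace - trunc L (ddot (p x) (D (e x))) * (w x / K) := by
      simp only [hw]
      ring
    -- The couplings from the two equations merge here into a single term with weight $1-\mathcal
    -- T_K(\theta)/K$.
    have e8 : f (trunc L (θ x + θl x)) * (1 - trunc K (θ x) / K) * (G x).trace
        = τ x * (G x).trace - τ x * (w x / K) * (G x).trace := by
      simp only [hw, hτ]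
      ring
    rw [e1, e7]
    rw [e8] at e2
    linarith
  have iw' : Integrable (fun x => trunc K (θ x) * θ' x) (bulk Ω) := by
    simpa only [mul_comm] using iθ'
  have iN : Integrable (fun x => θ' x * w x + (∑ i, q x i * (truncDeriv K (θ x) * q x i))
      - (- τ x * (G x).trace + trunc L (ddot (p x) (D (e x)))) * w x) (bulk Ω) :=
    (iθ'.add iq).sub irhs
  have hmono := integral_mono_ae
    (integrable_linearCombination i1 iw' iS iH (1 / K) (c / 2) (1 / K))
    (integrable_linearCombination iσ iN ibase iS (1 / K) (3 * C / c) (-(c / 4))) hpt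
  rw [integral_linearCombination i1 iw' iS iH, integral_linearCombination iσ iN ibase iS] at hmono
  have hN0 : ∫ x in Ω, (θ' x * w x + (∑ i, q x i * (truncDeriv K (θ x) * q x i))
      - (- τ x * (G x).trace + trunc L (ddot (p x) (D (e x)))) * w x) = 0 := by
    have h1 : Integrable (fun x => θ' x * w x + ∑ i, q x i * (truncDeriv K (θ x) * q x i))
      (bulk Ω) := iθ'.add iq
    rw [integral_sub h1 irhs, integral_add iθ' iq, hN, sub_self]
  rw [hN0, hM] at hmono
  have hsplit : ∫ x in Ω, (1 + |θ x| + θl x ^ 2 + ∑ i, F x i ^ 2)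
      = (∫ x in Ω, (1 + |θ x| + θl x ^ 2)) + ∫ x in Ω, ∑ i, F x i ^ 2 := integral_add ibase isF
  have hbase0 : 0 ≤ ∫ x in Ω, (1 + |θ x| + θl x ^ 2) := integral_nonneg fun x => by positivity
  have hF0 : 0 ≤ ∫ x in Ω, ∑ i, F x i ^ 2 :=
    integral_nonneg fun x => Finset.sum_nonneg fun i _ => sq_nonneg _
  have hC0 : 0 ≤ C := by
    have := (sq_nonneg _).trans (hgrowth 1 one_pos 0 0)
    simpa using this
  have h1 : 0 ≤ 3 * C / c * ∫ x in Ω, ∑ i, F x i ^ 2 := mul_nonneg (by positivity) hF0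
  have h2 : 0 ≤ 4 * R ^ 2 / c * ∫ x in Ω, (1 + |θ x| + θl x ^ 2) :=
    mul_nonneg (by positivity) hbase0
  rw [hsplit]
  linarith

section

variable {μ : Measure E3} [IsFiniteMeasure μ] {T t : ℝ}

lemma ae_memLp_slice {w : ℝ → E3 → ℝ} (h : MemLp (Function.uncurry w) 2 (timeProd T μ)) :
    ∀ᵐ s ∂(volume.restrict (Ioo (0 : ℝ) T)), MemLp (w s) 2 μ := by
  filter_upwards [h.integrable_sq.prod_right_ae, h.aestronglyMeasurable.prodMk_left] with s h1 h2
  exact (memLp_two_iff_integrable_sq h2).mpr h1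

/-- The fundamental theorem of calculus for the double contraction. -/
lemma integral_ddot_sub {A A' B B' : ℝ → E3 → Mat3}
    (hA : ∀ i j, IsTimeH1 T μ (fun t x => A t x i j) (fun t x => A' t x i j))
    (hB : ∀ i j, IsTimeH1 T μ (fun t x => B t x i j) (fun t x => B' t x i j))
    (ht : t ∈ Icc 0 T) :
    (∫ x, ddot (A t x) (B t x) ∂μ) - ∫ x, ddot (A 0 x) (B 0 x) ∂μ
      = ∫ s in (0 : ℝ)..t, ∫ x, (ddot (A' s x) (B s x) + ddot (A s x) (B' s x)) ∂μ := by
  have hint : Integrable (Function.uncurry fun s x =>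
      ddot (A' s x) (B s x) + ddot (A s x) (B' s x)) (timeProd t μ) :=
    Integrable.mono_measure
      ((integrable_ddot (fun i j => (hA i j).deriv_memLp) fun i j => (hB i j).memLp).add
        (integrable_ddot (fun i j => (hA i j).memLp) fun i j => (hB i j).deriv_memLp))
      (timeProd_mono ht.2)
  have h0 : (0 : ℝ) ∈ Icc 0 T := ⟨le_rfl, ht.1.trans ht.2⟩
  rw [intervalIntegral_integral_eq ht.1 hint, ← integral_sub
    (integrable_ddot (fun i j => (hA i j).memLp_slice ht) fun i j => (hB i j).memLp_slice ht)
    (integrable_ddot (fun i j => (hA i j).memLp_slice h0) fun i j => (hB i j).memLp_slice h0)]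
  refine integral_congr_ae ?_
  have h1 : ∀ᵐ x ∂μ, ∀ i j, A t x i j * B t x i j - A 0 x i j * B 0 x i j
      = ∫ s in (0 : ℝ)..t, (A' s x i j * B s x i j + A s x i j * B' s x i j) :=
    ae_all_iff.mpr fun i => ae_all_iff.mpr fun j => (hA i j).ae_mul_eq (hB i j) ht
  have h2 : ∀ᵐ x ∂μ, ∀ i j, IntervalIntegrable
      (fun s => A' s x i j * B s x i j + A s x i j * B' s x i j) volume 0 t :=
    ae_all_iff.mpr fun i => ae_all_iff.mpr fun j => ae_intervalIntegrable ht.1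
      (((hA i j).integrable_mul_deriv (hB i j)).mono_measure (timeProd_mono ht.2))
  filter_upwards [h1, h2] with x h3 h4
  simp only [ddot, ← Finset.sum_sub_distrib, ← Finset.sum_add_distrib, h3]
  have h5 : ∀ i, IntervalIntegrable
      (fun s => ∑ j, (A' s x i j * B s x i j + A s x i j * B' s x i j)) volume 0 t := fun i => by
    rw [intervalIntegrable_iff_Ioo ht.1]
    exact integrable_finsetSum _ fun j _ => (intervalIntegrable_iff_Ioo ht.1 _).mp (h4 i j)
  rw [intervalIntegral.integral_finsetSum fun i _ => h5 i]
  exact Finset.sum_congr rfl fun i _ =>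
    (intervalIntegral.integral_finsetSum fun j _ => h4 i j).symm

end

lemma IsTimeH1.linearMap {μ : Measure E3} [IsFiniteMeasure μ] {T : ℝ} (D : Mat3 →ₗ[ℝ] Mat3)
    {A A' : ℝ → E3 → Mat3}
    (hA : ∀ i j, IsTimeH1 T μ (fun t x => A t x i j) (fun t x => A' t x i j)) (i j : Fin 3) :
    IsTimeH1 T μ (fun t x => D (A t x) i j) (fun t x => D (A' t x) i j) := by
  simp_rw [linearMap_apply_entry D (A _ _) i j, linearMap_apply_entry D (A' _ _) i j]
  exact IsTimeH1.sum _ fun k _ => IsTimeH1.sum _ fun l _ => (hA k l).const_mul _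

lemma IsTimeH1.symPart {μ : Measure E3} [IsFiniteMeasure μ] {T : ℝ} {G G' : ℝ → E3 → Mat3}
    (hG : ∀ i j, IsTimeH1 T μ (fun t x => G t x i j) (fun t x => G' t x i j)) (i j : Fin 3) :
    IsTimeH1 T μ (fun t x => symPart (G t x) i j) (fun t x => symPart (G' t x) i j) := by
  have h := ((hG i j).sub ((hG j i).const_mul (-1))).const_mul (1 / 2)
  have e : ∀ A : Mat3, ThermoPlasticity.symPart A i j = 1 / 2 * (A i j - -1 * A j i) := fun A => by
    simp only [ThermoPlasticity.symPart, Matrix.smul_apply, Matrix.add_apply,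
      Matrix.transpose_apply, smul_eq_mul]
    ring
  simp_rw [e]
  exact h

/-! ### The energy of a solution and its balance over time -/

namespace Fields

/-- The elastic strain `ε(u) - ε^p`. -/
def elastic (s : Fields) (t : ℝ) (x : E3) : Mat3 := s.strain t x - s.ep t x

/-- The time derivative of the elastic strain. -/
def elasticRate (s : Fields) (t : ℝ) (x : E3) : Mat3 := s.strainRate t x - s.ept t x

/-- The stored energy, up to the part of the temperature that is not controlled. -/
def energy (Ω : Set E3) (D : Mat3 →ₗ[ℝ] Mat3) (K : ℝ) (s : Fields) (t : ℝ) : ℝ :=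
  1 / 2 * (∫ x in Ω, ddot (D (s.elastic t x)) (s.elastic t x))
    + 1 / K * ∫ x in Ω, truncPrim K (s.th t x)

/-- The gradient of the truncated temperature. -/
def truncGrad (K : ℝ) (s : Fields) (t : ℝ) (x : E3) (i : Fin 3) : ℝ :=
  truncDeriv K (s.th t x) * s.Gth t x i

end Fields

namespace IsApproxSolution

variable {Ω : Set E3} {T : ℝ} {D : Mat3 →ₗ[ℝ] Mat3} {k : ℝ} {f : ℝ → ℝ} {F : ℝ → E3 → Fin 3 → ℝ}
  {u0 : E3 → Fin 3 → ℝ} {ep0 : E3 → Mat3} {th0 : E3 → ℝ} {thl : ℝ → E3 → ℝ} {lam : ℝ} {s : Fields}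

lemma strain_time (hb : Bornology.IsBounded Ω)
    (hs : IsApproxSolution Ω T D k f F u0 ep0 th0 thl lam s) (i j : Fin 3) :
    IsTimeH1 T (bulk Ω) (fun t x => s.strain t x i j) (fun t x => s.strainRate t x i j) :=
  have := isFiniteMeasure_bulk hb
  IsTimeH1.symPart hs.Gu_time i j

lemma elastic_time (hb : Bornology.IsBounded Ω)
    (hs : IsApproxSolution Ω T D k f F u0 ep0 th0 thl lam s) (i j : Fin 3) :
    IsTimeH1 T (bulk Ω) (fun t x => s.elastic t x i j) (fun t x => s.elasticRate t x i j) :=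
  have := isFiniteMeasure_bulk hb
  (hs.strain_time hb i j).sub (hs.ep_time i j)

lemma elastic_symm (hs : IsApproxSolution Ω T D k f F u0 ep0 th0 thl lam s) {t : ℝ}
    (ht : t ∈ Icc 0 T) : ∀ᵐ x ∂(bulk Ω), (s.elastic t x).IsSymm := by
  filter_upwards [hs.ep_symm t ht] with x hx
  exact (isSymm_symPart _).sub hx

lemma integrable_strainRate (hb : Bornology.IsBounded Ω)
    (hs : IsApproxSolution Ω T D k f F u0 ep0 th0 thl lam s) :
    Integrable (Function.uncurry fun t x => ddot (s.strainRate t x) (s.strainRate t x))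
      (timeProd T (bulk Ω)) :=
  integrable_ddot (fun i j => (hs.strain_time hb i j).deriv_memLp)
    fun i j => (hs.strain_time hb i j).deriv_memLp

lemma memLp_truncGrad (hs : IsApproxSolution Ω T D k f F u0 ep0 th0 thl lam s) {K : ℝ}
    (hK : 0 ≤ K) (i : Fin 3) :
    MemLp (Function.uncurry fun t x => s.truncGrad K t x i) 2 (timeProd T (bulk Ω)) := by
  have hm : AEStronglyMeasurable (fun z : ℝ × E3 => truncDeriv K (s.th z.1 z.2))
      (timeProd T (bulk Ω)) :=
    ((measurable_truncDeriv K).comp_aemeasurable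
      hs.th_regular.time.memLp.aestronglyMeasurable.aemeasurable).aestronglyMeasurable
  refine (hs.th_regular.grad_memLp i).mono
    (hm.mul (hs.th_regular.grad_memLp i).aestronglyMeasurable) (Eventually.of_forall fun z => ?_)
  simp only [Function.uncurry, Fields.truncGrad]
  rw [norm_mul, Real.norm_eq_abs, abs_of_nonneg (truncDeriv_nonneg hK _)]
  exact mul_le_of_le_one_left (norm_nonneg _) (truncDeriv_le_one K _)

lemma integrable_truncGrad (hs : IsApproxSolution Ω T D k f F u0 ep0 th0 thl lam s) {K : ℝ}
    (hK : 0 ≤ K) :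
    Integrable (Function.uncurry fun t x => ∑ i, s.truncGrad K t x i ^ 2)
      (timeProd T (bulk Ω)) :=
  integrable_finsetSum _ fun i _ => (hs.memLp_truncGrad hK i).integrable_sq

lemma truncGrad_memH1 (hΩ : IsOpen Ω) (hb : Bornology.IsBounded Ω)
    (hs : IsApproxSolution Ω T D k f F u0 ep0 th0 thl lam s) {K : ℝ} (hK : 0 ≤ K) :
    ∀ᵐ t ∂(volume.restrict (Ioo (0 : ℝ) T)),
      MemH1 Ω (fun x => trunc K (s.th t x)) (s.truncGrad K t) :=
  hs.th_regular.grad.mono fun _ ht => ht.trunc hΩ hb hK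

/-- The integrated energy inequality. -/
lemma energy_inequality (hΩ : IsOpen Ω) (hb : Bornology.IsBounded Ω) {R : ℝ}
    (hR0 : 0 < R) (hR : ∀ x ∈ Ω, ‖x‖ ≤ R) (hD : IsElasticityTensor D)
    {c : ℝ} (hc : 0 < c) (hcD : ∀ A : Mat3, A.IsSymm → c * ddot A A ≤ ddot (D A) A)
    (hf : Continuous f) {K C : ℝ} (hK : 0 < K)
    (hgrowth : ∀ L, 0 < L → ∀ a b,
      (f (trunc L (a + b)) * (1 - trunc K a / K)) ^ 2 ≤ C * (1 + |a| + b ^ 2))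
    (hF : ∀ i, MemLp (fun p : ℝ × E3 => F p.1 p.2 i) 2 (timeProd T (bulk Ω)))
    (hthl : MemLp (Function.uncurry thl) 2 (timeProd T (bulk Ω))) (hlam : 0 < lam)
    (hs : IsApproxSolution Ω T D k f F u0 ep0 th0 thl lam s) {t : ℝ} (ht : t ∈ Icc 0 T) :
    s.energy Ω D K t
        + c / 2 * (∫ τ in (0 : ℝ)..t, ∫ x in Ω, ddot (s.strainRate τ x) (s.strainRate τ x))
        + 1 / K * (∫ τ in (0 : ℝ)..t, ∫ x in Ω, ∑ i, s.truncGrad K τ x i ^ 2)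
      ≤ s.energy Ω D K 0 + (3 * C / c + 4 * R ^ 2 / c)
        * ((∫ τ in (0 : ℝ)..t, ∫ x in Ω, (1 + thl τ x ^ 2 + ∑ i, F τ x i ^ 2))
          + ∫ τ in (0 : ℝ)..t, ∫ x in Ω, |s.th τ x|) := by
  have hfin := isFiniteMeasure_bulk hb
  have het := hs.elastic_time hb
  have hDet := IsTimeH1.linearMap D het
  have hth := hs.th_regular.time
  -- integrability in space-time
  have iA : Integrable (Function.uncurry fun τ x =>
      ddot (D (s.elasticRate τ x)) (s.elastic τ x) + ddot (D (s.elastic τ x)) (s.elasticRate τ x))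
      (timeProd T (bulk Ω)) :=
    (integrable_ddot (fun i j => (hDet i j).deriv_memLp) fun i j => (het i j).memLp).add
      (integrable_ddot (fun i j => (hDet i j).memLp) fun i j => (het i j).deriv_memLp)
  have iB := hth.integrable_trunc_mul_deriv hK.le
  have iS := hs.integrable_strainRate hb
  have iH := hs.integrable_truncGrad hK.le
  have iDat : Integrable (Function.uncurry fun τ x => 1 + thl τ x ^ 2 + ∑ i, F τ x i ^ 2)
      (timeProd T (bulk Ω)) :=
    ((integrable_const (1 : ℝ)).add hthl.integrable_sq).add
      (integrable_finsetSum _ fun i _ => (hF i).integrable_sq)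
  have iY : Integrable (Function.uncurry fun τ x => |s.th τ x|) (timeProd T (bulk Ω)) :=
    hth.integrable.abs
  have toI : ∀ {H : ℝ → E3 → ℝ}, Integrable (Function.uncurry H) (timeProd T (bulk Ω)) →
      IntervalIntegrable (fun τ => ∫ x in Ω, H τ x) volume 0 t := fun h =>
    intervalIntegrable_integral ht.1 (h.mono_measure (timeProd_mono ht.2))
  -- the inequality at almost every time
  have hslice : ∀ᵐ τ ∂(volume.restrict (Ioo (0 : ℝ) T)),
      1 / 2 * (∫ x in Ω, (ddot (D (s.elasticRate τ x)) (s.elastic τ x)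
          + ddot (D (s.elastic τ x)) (s.elasticRate τ x)))
        + 1 / K * (∫ x in Ω, trunc K (s.th τ x) * s.tht τ x)
        + c / 2 * (∫ x in Ω, ddot (s.strainRate τ x) (s.strainRate τ x))
        + 1 / K * (∫ x in Ω, ∑ i, s.truncGrad K τ x i ^ 2)
      ≤ (3 * C / c + 4 * R ^ 2 / c) * ((∫ x in Ω, (1 + thl τ x ^ 2 + ∑ i, F τ x i ^ 2))
          + ∫ x in Ω, |s.th τ x|) := by
    have hept : ∀ᵐ τ ∂(volume.restrict (Ioo (0 : ℝ) T)), ∀ i j,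
        MemLp (fun x => s.ept τ x i j) 2 (bulk Ω) :=
      ae_all_iff.mpr fun i => ae_all_iff.mpr fun j => ae_memLp_slice (hs.ep_time i j).deriv_memLp
    have hFs : ∀ᵐ τ ∂(volume.restrict (Ioo (0 : ℝ) T)), ∀ i,
        MemLp (fun x => F τ x i) 2 (bulk Ω) := ae_all_iff.mpr fun i => ae_memLp_slice (hF i)
    filter_upwards [ae_restrict_mem measurableSet_Ioo, hept, hFs, ae_memLp_slice hth.deriv_memLp,
      ae_memLp_slice hthl, Measure.ae_ae_of_ae_prod hs.flow, hs.ut_memH10, hs.th_regular.grad,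
      hs.momentum, hs.heat, iDat.prod_right_ae] with τ hτ h1 h2 h3 h4 h5 h6 h7 h8 h9 h10
    have hτ' : τ ∈ Icc 0 T := ⟨hτ.1.le, hτ.2.le⟩
    have hsymm := hs.elastic_symm hτ'
    have h := energy_inequality_slice hΩ hb hR0 hR hD hc hcD hf hK hgrowth hlam
      (e := s.elastic τ) (p := s.ept τ) (G := s.Gut τ) (u := s.ut τ) (F := F τ) (q := s.Gth τ)
      (θ := s.th τ) (θ' := s.tht τ) (θl := thl τ)
      (fun i j => (het i j).memLp_slice hτ') hsymm h1 h5 h6 h2 h7 h3 h4 h8 h9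
    -- Symmetry of `D` merges the two terms of the product rule. It applies only to symmetric
    -- matrices; symmetry of the plastic rate comes from the flow rule.
    have e1 : ∫ x in Ω, (ddot (D (s.elasticRate τ x)) (s.elastic τ x)
          + ddot (D (s.elastic τ x)) (s.elasticRate τ x))
        = 2 * ∫ x in Ω, ddot (D (s.elastic τ x)) (symPart (s.Gut τ x) - s.ept τ x) := by
      rw [← integral_const_mul]
      refine integral_congr_ae ?_
      filter_upwards [hsymm, h5] with x hx hx5
      have hrs : (s.elasticRate τ x).IsSymm := by
        refine (isSymm_symPart _).sub ?_
        rw [hx5]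
        exact isSymm_yosida (hD.map_symm _ hx)
      rw [hD.symmetric _ _ hrs hx, ddot_comm]
      simp only [Fields.elasticRate, Fields.strainRate]
      ring
    have e2 : ∫ x in Ω, (1 + |s.th τ x| + thl τ x ^ 2 + ∑ i, F τ x i ^ 2)
        = (∫ x in Ω, (1 + thl τ x ^ 2 + ∑ i, F τ x i ^ 2)) + ∫ x in Ω, |s.th τ x| := by
      have h11 : Integrable (fun x => 1 + thl τ x ^ 2 + ∑ i, F τ x i ^ 2) (bulk Ω) := h10
      rw [← integral_add h11 (hth.integrable_slice hτ').abs]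
      refine integral_congr_ae (Eventually.of_forall fun x => ?_)
      ring
    rw [e2] at h
    rw [e1]
    simp only [Fields.strainRate, Fields.truncGrad]
    linarith
  -- integration in time
  have hmono := intervalIntegral.integral_mono_ae_restrict (μ := volume) ht.1
    (((((toI iA).const_mul (1 / 2)).add ((toI iB).const_mul (1 / K))).add
      ((toI iS).const_mul (c / 2))).add ((toI iH).const_mul (1 / K)))
    (((toI iDat).add (toI iY)).const_mul (3 * C / c + 4 * R ^ 2 / c)) (by
      rw [← Measure.restrict_congr_set (Ioo_ae_eq_Icc (μ := volume) (a := (0 : ℝ)) (b := t))]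
      exact ae_restrict_of_ae_restrict_of_subset (Ioo_subset_Ioo_right ht.2) hslice)
  rw [intervalIntegral.integral_add ((((toI iA).const_mul (1 / 2)).add
      ((toI iB).const_mul (1 / K))).add ((toI iS).const_mul (c / 2))) ((toI iH).const_mul (1 / K)),
    intervalIntegral.integral_add (((toI iA).const_mul (1 / 2)).add
      ((toI iB).const_mul (1 / K))) ((toI iS).const_mul (c / 2)),
    intervalIntegral.integral_add ((toI iA).const_mul (1 / 2)) ((toI iB).const_mul (1 / K)),
    intervalIntegral.integral_const_mul, intervalIntegral.integral_const_mul,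
    intervalIntegral.integral_const_mul, intervalIntegral.integral_const_mul,
    intervalIntegral.integral_const_mul,
    intervalIntegral.integral_add (toI iDat) (toI iY),
    ← integral_ddot_sub hDet het ht, ← hth.integral_truncPrim_sub hK.le ht] at hmono
  unfold Fields.energy
  linarith

/-- The initial energy is determined by the initial data. -/
lemma energy_zero_eq (hΩ : IsOpen Ω) (hb : Bornology.IsBounded Ω) (hT : 0 ≤ T)
    {g0 : Fin 3 → E3 → Fin 3 → ℝ} (hu0 : ∀ i, MemH1 Ω (fun x => u0 x i) (g0 i)) (K : ℝ)
    (hs : IsApproxSolution Ω T D k f F u0 ep0 th0 thl lam s) :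
    s.energy Ω D K 0 =
      1 / 2 * (∫ x in Ω, ddot (D (symPart (Matrix.of fun i j => g0 i x j) - ep0 x))
        (symPart (Matrix.of fun i j => g0 i x j) - ep0 x))
      + 1 / K * ∫ x in Ω, truncPrim K (th0 x) := by
  have hfin := isFiniteMeasure_bulk hb
  have hG : ∀ᵐ x ∂(bulk Ω), ∀ i j, s.Gu 0 x i j = g0 i x j :=
    ae_all_iff.mpr fun i => ae_all_iff.mpr fun j => by
      have h := (hs.u_memH10 0 ⟨le_rfl, hT⟩ i).memH1
      exact h.weakGrad.ae_eq hΩ (hu0 i).weakGrad (hs.u_init.mono fun x hx => congrFun hx i)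
        (fun i => (h.grad_memLp i).integrable (by norm_num))
        (fun j => ((hu0 i).grad_memLp j).integrable (by norm_num)) j
  unfold Fields.energy
  congr 2
  · refine integral_congr_ae ?_
    filter_upwards [hG, hs.ep_init] with x h1 h2
    have h3 : s.Gu 0 x = Matrix.of fun i j => g0 i x j := by
      ext i j
      exact h1 i j
    simp only [Fields.elastic, Fields.strain, h2, h3]
  · refine integral_congr_ae ?_
    filter_upwards [hs.th_init] with x h1
    rw [h1]

/-- Trades the thermal part of the energy for the $L^1$ norm in which the Gronwall loop closes, at
the cost of the constant $\frac K2|\Omega|$. -/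
lemma integral_abs_th_le (hb : Bornology.IsBounded Ω) {K : ℝ} (hK : 0 < K)
    (hs : IsApproxSolution Ω T D k f F u0 ep0 th0 thl lam s) {t : ℝ} (ht : t ∈ Icc 0 T) :
    ∫ x in Ω, |s.th t x|
      ≤ 1 / K * (∫ x in Ω, truncPrim K (s.th t x)) + K / 2 * (bulk Ω).real univ := by
  have hfin := isFiniteMeasure_bulk hb
  have h1 := hs.th_regular.time.integrable_slice ht
  have h2 := IsTimeH1.integrable_truncPrim hK.le h1
  calc ∫ x in Ω, |s.th t x| ≤ ∫ x in Ω, (1 / K * truncPrim K (s.th t x) + K / 2) := by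
        refine integral_mono h1.abs ((h2.const_mul _).add (integrable_const _)) fun x => ?_
        have h3 := mul_le_mul_of_nonneg_left (le_truncPrim hK.le (s.th t x)) (one_div_pos.mpr hK).le
        have h4 : 1 / K * (K * |s.th t x| - K ^ 2 / 2) = |s.th t x| - K / 2 := by
          field_simp
        simp only
        linarith
    _ = _ := by
        rw [integral_add (h2.const_mul _) (integrable_const _), integral_const_mul, integral_const,
          smul_eq_mul]
        ring

end IsApproxSolution

end ThermoPlasticity
end

/-! ### Gronwall's inequality and the uniform bound -/

open ThermoPlasticity MeasureTheory Set Filter in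
theorem theorem4p1
    (Ω : Set ThermoPlasticity.E3) (hΩ : ThermoPlasticity.IsBoundedC2Domain Ω)
    (T : ℝ) (hT : 0 < T)
    (D : ThermoPlasticity.Mat3 →ₗ[ℝ] ThermoPlasticity.Mat3)
    (hD : ThermoPlasticity.IsElasticityTensor D)
    (k : ℝ) (hk : 0 < k)
    -- the constitutive function and its growth conditions
    (f : ℝ → ℝ) (hf : Continuous f)
    (hf_growth : ∃ a M α : ℝ, 0 ≤ a ∧ 0 ≤ M ∧ 1 / 2 < α ∧ α < 5 / 6 ∧
      ∀ r : ℝ, |f r| ≤ a + M * |r| ^ α)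
    (hf_neg : ∃ C : ℝ, 0 < C ∧ ∀ r : ℝ, r < 0 → |f r| ≤ C * (1 + |r|) ^ (1 / 2 : ℝ))
    -- the data: volume force, initial values, Neumann datum and its lift
    (F : ℝ → ThermoPlasticity.E3 → Fin 3 → ℝ)
    (hF : ∀ i, MeasureTheory.MemLp (fun p : ℝ × ThermoPlasticity.E3 => F p.1 p.2 i) 2
      (ThermoPlasticity.timeProd T (ThermoPlasticity.bulk Ω)))
    (u0 : ThermoPlasticity.E3 → Fin 3 → ℝ)
    (hu0 : ∀ i, ∃ g, ThermoPlasticity.MemH1 Ω (fun x => u0 x i) g)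
    (ep0 : ThermoPlasticity.E3 → ThermoPlasticity.Mat3)
    (hep0 : ∀ i j, MeasureTheory.MemLp (fun x => ep0 x i j) 2 (ThermoPlasticity.bulk Ω))
    (hep0_symm : ∀ᵐ x ∂(ThermoPlasticity.bulk Ω), (ep0 x).IsSymm)
    (th0 : ThermoPlasticity.E3 → ℝ)
    (hth0 : ∃ g, ThermoPlasticity.MemH1 Ω th0 g)
    (g : ℝ → ThermoPlasticity.E3 → ℝ)
    (hg : ∃ g', ThermoPlasticity.IsTimeH1 T (ThermoPlasticity.surf Ω) g g')
    (thl : ℝ → ThermoPlasticity.E3 → ℝ)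
    (hthl : ThermoPlasticity.IsNeumannLift Ω T g thl)
    (K : ℝ) (hK : 0 < K) :
    ∃ C : ℝ, 0 < C ∧ ∀ lam : ℝ, 0 < lam → ∀ s : ThermoPlasticity.Fields,
      ThermoPlasticity.IsApproxSolution Ω T D k f F u0 ep0 th0 thl lam s →
      -- `H` is the gradient of the truncated temperature
      ∃ H : ℝ → ThermoPlasticity.E3 → Fin 3 → ℝ,
        (∀ᵐ t ∂(MeasureTheory.volume.restrict (Set.Ioo (0 : ℝ) T)),
          ThermoPlasticity.MemH1 Ω (fun x => ThermoPlasticity.trunc K (s.th t x)) (H t)) ∧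
        -- the space-time integrands are integrable
        MeasureTheory.Integrable
          (fun p : ℝ × ThermoPlasticity.E3 =>
            ThermoPlasticity.frob (s.strainRate p.1 p.2) ^ 2)
          (ThermoPlasticity.timeProd T (ThermoPlasticity.bulk Ω)) ∧
        MeasureTheory.Integrable
          (fun p : ℝ × ThermoPlasticity.E3 => ∑ i, H p.1 p.2 i ^ 2)
          (ThermoPlasticity.timeProd T (ThermoPlasticity.bulk Ω)) ∧
        ∀ t ∈ Set.Icc (0 : ℝ) T,
          MeasureTheory.IntegrableOn
            (fun x => ThermoPlasticity.frob (s.stress D t x) ^ 2) Ω ∧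
          MeasureTheory.IntegrableOn (s.th t) Ω ∧
          (∫ x in Ω, ThermoPlasticity.frob (s.stress D t x) ^ 2)
            + (∫ τ in (0 : ℝ)..t, ∫ x in Ω, ThermoPlasticity.frob (s.strainRate τ x) ^ 2)
            + (∫ x in Ω, |s.th t x|)
            + (∫ τ in (0 : ℝ)..t, ∫ x in Ω, ∑ i, H τ x i ^ 2) ≤ C := by
  obtain ⟨a₀, M, α, ha₀, hM, hα, hα', hfg⟩ := hf_growth
  obtain ⟨C₀, -, hfn⟩ := hf_neg
  obtain ⟨C₁, hC₁, hgrowth⟩ := exists_growth_bound hα hα' ha₀ hM hfg hfn hK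
  obtain ⟨c, hc, hcD⟩ := hD.exists_coercive
  obtain ⟨Cp, hCp, hCpD⟩ := hD.exists_ddot_apply_le
  obtain ⟨R, hR0, hR⟩ := hΩ.isBounded.exists_pos_norm_le
  obtain ⟨_, _, hreg, _⟩ := hthl
  choose g0 hg0 using hu0
  have hO := hΩ.isOpen
  have hb := hΩ.isBounded
  have hfin := isFiniteMeasure_bulk hb
  have hthl2 := hreg.time.memLp
  set E₀ : ℝ := 1 / 2 * (∫ x in Ω, ddot (D (symPart (Matrix.of fun i j => g0 i x j) - ep0 x))
      (symPart (Matrix.of fun i j => g0 i x j) - ep0 x))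
    + 1 / K * ∫ x in Ω, truncPrim K (th0 x) with hE₀
  set C : ℝ := 3 * C₁ / c + 4 * R ^ 2 / c with hCdef
  have hC : 0 < C := by positivity
  set d : ℝ → E3 → ℝ := fun τ x => 1 + thl τ x ^ 2 + ∑ i, F τ x i ^ 2 with hd
  have hd0 : ∀ τ x, 0 ≤ d τ x := fun τ x =>
    add_nonneg (by positivity) (Finset.sum_nonneg fun i _ => sq_nonneg _)
  have hdint : Integrable (Function.uncurry d) (timeProd T (bulk Ω)) :=
    ((integrable_const (1 : ℝ)).add hthl2.integrable_sq).add
      (integrable_finsetSum _ fun i _ => (hF i).integrable_sq)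
  set V : ℝ := (bulk Ω).real univ with hV
  -- The data side of the estimate: initial energy, the loss in passing from `truncPrim` to the
  -- absolute value, and the space-time integrals of force and lift. None of these depends on `lam`.
  set c₀ : ℝ := |E₀| + K / 2 * V + C * ∫ τ in (0 : ℝ)..T, ∫ x in Ω, d τ x with hc₀def
  have hV0 : 0 ≤ V := measureReal_nonneg
  have hdT : 0 ≤ ∫ τ in (0 : ℝ)..T, ∫ x in Ω, d τ x :=
    intervalIntegral.integral_nonneg hT.le fun τ _ => integral_nonneg fun x => hd0 τ x
  have hc₀ : 0 ≤ c₀ := by positivity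
  set Y : ℝ := 2 * c₀ * Real.exp (2 * C * T) with hY
  have hY0 : 0 ≤ Y := by positivity
  set W : ℝ := c₀ + C * (Y * T) with hW
  have hW0 : 0 ≤ W := by positivity
  -- `W` bounds the whole left side of the energy estimate after Gronwall. The summands account for
  -- the stress, the strain rate, the temperature and the truncated gradient; the final 1 ensures
  -- positivity.
  refine ⟨2 * Cp * W + 2 / c * W + W + K * W + 1, by positivity, fun lam hlam s hs => ?_⟩
  refine ⟨s.truncGrad K, hs.truncGrad_memH1 hO hb hK.le, ?_, hs.integrable_truncGrad hK.le, ?_⟩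
  · refine (hs.integrable_strainRate hb).congr (Eventually.of_forall fun z => ?_)
    exact (frob_sq _).symm
  have hth := hs.th_regular.time
  have hyint : ∀ t ∈ Icc 0 T, IntervalIntegrable (fun τ => ∫ x in Ω, |s.th τ x|) volume 0 t :=
    fun t ht => intervalIntegrable_integral ht.1
      (Integrable.mono_measure (Integrable.abs hth.integrable) (timeProd_mono ht.2))
  have hDeDe : ∀ t ∈ Icc 0 T, ∀ i j, MemLp (fun x => D (s.elastic t x) i j) 2 (bulk Ω) :=
    fun t ht => memLp_linearMap D fun i j => (hs.elastic_time hb i j).memLp_slice ht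
  have hS0 : ∀ t ∈ Icc 0 T,
      0 ≤ ∫ τ in (0 : ℝ)..t, ∫ x in Ω, ddot (s.strainRate τ x) (s.strainRate τ x) := fun t ht =>
    intervalIntegral.integral_nonneg ht.1 fun τ _ => integral_nonneg fun x => ddot_self_nonneg _
  have hH0 : ∀ t ∈ Icc 0 T,
      0 ≤ ∫ τ in (0 : ℝ)..t, ∫ x in Ω, ∑ i, s.truncGrad K τ x i ^ 2 := fun t ht =>
    intervalIntegral.integral_nonneg ht.1 fun τ _ => integral_nonneg fun x =>
      Finset.sum_nonneg fun i _ => sq_nonneg _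
  have hstress : ∀ t ∈ Icc 0 T, Integrable (fun x => ddot (s.stress D t x) (s.stress D t x))
      (bulk Ω) := fun t ht => integrable_ddot (hDeDe t ht) (hDeDe t ht)
  have hQ : ∀ t ∈ Icc 0 T, ∫ x in Ω, ddot (s.stress D t x) (s.stress D t x)
      ≤ Cp * ∫ x in Ω, ddot (D (s.elastic t x)) (s.elastic t x) := fun t ht => by
    rw [← integral_const_mul]
    refine integral_mono_ae (hstress t ht) ((integrable_ddot (hDeDe t ht)
      fun i j => (hs.elastic_time hb i j).memLp_slice ht).const_mul Cp) ?_
    filter_upwards [hs.elastic_symm ht] with x hx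
    exact hCpD _ hx
  have hQ0 : ∀ t, 0 ≤ ∫ x in Ω, ddot (s.stress D t x) (s.stress D t x) := fun t =>
    integral_nonneg fun x => ddot_self_nonneg _
  have hQ0' : ∀ t ∈ Icc 0 T, 0 ≤ ∫ x in Ω, ddot (D (s.elastic t x)) (s.elastic t x) :=
    fun t ht => nonneg_of_mul_nonneg_right ((hQ0 t).trans (hQ t ht)) hCp
  -- the energy estimate, before Gronwall's inequality is used
  have hmain : ∀ t ∈ Icc 0 T,
      1 / 2 * (∫ x in Ω, ddot (D (s.elastic t x)) (s.elastic t x)) + (∫ x in Ω, |s.th t x|)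
        + c / 2 * (∫ τ in (0 : ℝ)..t, ∫ x in Ω, ddot (s.strainRate τ x) (s.strainRate τ x))
        + 1 / K * (∫ τ in (0 : ℝ)..t, ∫ x in Ω, ∑ i, s.truncGrad K τ x i ^ 2)
      ≤ c₀ + C * ∫ τ in (0 : ℝ)..t, ∫ x in Ω, |s.th τ x| := fun t ht => by
    have h1 := hs.energy_inequality hO hb hR0 hR hD hc hcD hf hK hgrowth hF hthl2 hlam ht
    rw [hs.energy_zero_eq hO hb hT.le hg0 K, ← hE₀, ← hCdef, mul_add, Fields.energy] at h1
    have h2 := hs.integral_abs_th_le hb hK ht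
    have h3 : ∫ τ in (0 : ℝ)..t, ∫ x in Ω, d τ x ≤ ∫ τ in (0 : ℝ)..T, ∫ x in Ω, d τ x :=
      intervalIntegral.integral_mono_interval le_rfl ht.1 ht.2
        (Eventually.of_forall fun τ => integral_nonneg fun x => hd0 τ x)
        (intervalIntegrable_integral hT.le hdint)
    have h4 := mul_le_mul_of_nonneg_left h3 hC.le
    have h5 := le_abs_self E₀
    linarith
  have hbound : ∀ t ∈ Icc 0 T, ∫ x in Ω, |s.th t x| ≤ Y := fun t ht => by
    -- The a priori bound supplied here depends on the solution, but Gronwall's conclusion involves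
    -- only `c₀` and `C`.
    have h := le_exp_of_le_integral (y := fun t => ∫ x in Ω, |s.th t x|) hc₀ hC
      (fun t ht => hth.integral_abs_le ht)
      (fun t => integral_nonneg fun x => abs_nonneg _) (hyint T ⟨hT.le, le_rfl⟩)
      (fun t ht => by
        have h1 := hmain t ht
        have h2 := mul_nonneg (by positivity : 0 ≤ c / 2) (hS0 t ht)
        have h3 := mul_nonneg (by positivity : 0 ≤ 1 / K) (hH0 t ht)
        have h4 := hQ0' t ht
        linarith) t ht
    refine h.trans (mul_le_mul_of_nonneg_left (Real.exp_le_exp.mpr ?_) (by positivity))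
    exact mul_le_mul_of_nonneg_left ht.2 (by positivity)
  intro t ht
  have hth0 : 0 ≤ ∫ x in Ω, |s.th t x| := integral_nonneg fun x => abs_nonneg _
  have hW' : 1 / 2 * (∫ x in Ω, ddot (D (s.elastic t x)) (s.elastic t x)) + (∫ x in Ω, |s.th t x|)
        + c / 2 * (∫ τ in (0 : ℝ)..t, ∫ x in Ω, ddot (s.strainRate τ x) (s.strainRate τ x))
        + 1 / K * (∫ τ in (0 : ℝ)..t, ∫ x in Ω, ∑ i, s.truncGrad K τ x i ^ 2) ≤ W := by
    refine (hmain t ht).trans (add_le_add le_rfl (mul_le_mul_of_nonneg_left ?_ hC.le))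
    have h1 : ∫ τ in (0 : ℝ)..t, ∫ x in Ω, |s.th τ x| ≤ ∫ _ in (0 : ℝ)..t, Y :=
      intervalIntegral.integral_mono_on ht.1 (hyint t ht) (by simp)
        fun τ hτ => hbound τ ⟨hτ.1, hτ.2.trans ht.2⟩
    rw [intervalIntegral.integral_const, smul_eq_mul, sub_zero, mul_comm] at h1
    exact h1.trans (mul_le_mul_of_nonneg_left ht.2 hY0)
  have p1 := hQ0' t ht
  have p2 := mul_nonneg (by positivity : 0 ≤ c / 2) (hS0 t ht)
  have p3 := mul_nonneg (by positivity : 0 ≤ 1 / K) (hH0 t ht)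
  refine ⟨?_, hth.integrable_slice ht, ?_⟩
  · exact (hstress t ht).congr (Eventually.of_forall fun x => (frob_sq _).symm)
  simp only [frob_sq]
  have q1 : ∫ x in Ω, ddot (s.stress D t x) (s.stress D t x) ≤ 2 * Cp * W := by
    refine (hQ t ht).trans ?_
    have : ∫ x in Ω, ddot (D (s.elastic t x)) (s.elastic t x) ≤ 2 * W := by linarith
    calc _ ≤ Cp * (2 * W) := mul_le_mul_of_nonneg_left this hCp.le
      _ = _ := by ring
  have q2 : ∫ τ in (0 : ℝ)..t, ∫ x in Ω, ddot (s.strainRate τ x) (s.strainRate τ x)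
      ≤ 2 / c * W := by
    have h1 : c / 2 * (∫ τ in (0 : ℝ)..t, ∫ x in Ω, ddot (s.strainRate τ x) (s.strainRate τ x))
      ≤ W := by linarith
    have h2 := mul_le_mul_of_nonneg_left h1 (by positivity : 0 ≤ 2 / c)
    rwa [← mul_assoc, show 2 / c * (c / 2) = 1 by field_simp, one_mul] at h2
  have q3 : ∫ τ in (0 : ℝ)..t, ∫ x in Ω, ∑ i, s.truncGrad K τ x i ^ 2 ≤ K * W := by
    have h1 : 1 / K * (∫ τ in (0 : ℝ)..t, ∫ x in Ω, ∑ i, s.truncGrad K τ x i ^ 2) ≤ W := by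
      linarith
    have h2 := mul_le_mul_of_nonneg_left h1 hK.le
    rwa [← mul_assoc, show K * (1 / K) = 1 by field_simp, one_mul] at h2
  linarith
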